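/- Let $A=\mathbb F_q[t]$, $F=\mathbb F_q(t)$, let $K$ be a finite extension of $F$ and let $\mathcal O_K$ be the integral closure of $A$ in $K$. Let $\phi:A\to\mathcal O_K\{\tau\}$, $a\mapsto\phi_a$, be a Drinfeld module of rank $d$ defined over $\mathcal O_K$ (where $\tau u=u^q\tau$, the constant coefficient of $\phi_a$ is $a$, and $\deg_\tau\phi_a=d\deg a$ for $a\neq 0$) with $\operatorname{End}_K(\phi)=A$. Let $\phi(\mathcal O_K)$ be the additive group of $\mathcal O_K$ with the $A$-module structure given by evaluating the $\phi_a$. A maximal ideal $\mathcal W$ of $\mathcal O_K$ is called good if there is $\alpha\in K^\times$ such that $\alpha\phi\alpha^{-1}$ has $\mathcal W$-integral coefficients and its reduction modulo $\mathcal W$ is a Drinfeld module of rank $d$ over $\mathcal O_K/\mathcal W$. At such a $\mathcal W$ the reduction $\mathrm{red}_{\mathcal W}$ of points is taken on the model $\alpha\phi\alpha^{-1}$, that is $x\mapsto \alpha x \bmod \mathcal W$ (for almost all $\mathcal W$ one can take $\alpha=1$, and $\mathrm{red}_{\mathcal W}(x)=x\bmod\mathcal W$). Put $e=d+1$; all reductions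 on $\phi(\mathcal O_K)^e$ are coordinatewise. 1. There exist points $P_1,\dots,P_e\in\phi(\mathcal O_K)$ that are linearly independent over $A$. 2. Let $P_1,\dots,P_e\in\phi(\mathcal O_K)$ be any points linearly independent over $A$, and let $P=(P_1,\dots,P_e)^T\in\phi(\mathcal O_K)^e$. (a) Let $\Lambda=\{MP : M\in\mathrm{Mat}_{e\times e}(A),\ \operatorname{tr}M=0\}$. Then $\mathrm{red}_{\mathcal W}(P)\in\mathrm{red}_{\mathcal W}(\Lambda)$ for every good $\mathcal W$ (and every admissible $\alpha$). Moreover $P\notin\Lambda+(\phi(\mathcal O_K)^e)_{\mathrm{tor}}$ if and only if the characteristic of $\mathbb F_q$ does not divide $d+1$. (b) In every characteristic there is an $A$-submodule $\Lambda'$ of $(AP_1+\dots+AP_e)^e$ such that $\mathrm{red}_{\mathcal W}(P)\in\mathrm{red}_{\mathcal W}(\Lambda')$ for every good $\mathcal W$ (and every admissible $\alpha$), but $P\notin\Lambda'+(\phi(\mathcal O_K)^e)_{\mathrm{tor}}$. 3. Consequently the local to global principle fails for the $\mathbf t$-module $\phi^{d+1}$. That is, the following statement is false: for every finitely generated $A$-submodule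 $N_1\subset\phi(\mathcal O_K)$, every $A$-submodule $\Lambda\subset N=N_1^{d+1}$ and every $P\in N$ such that $\mathrm{red}_{\mathcal W}(P)\in\mathrm{red}_{\mathcal W}(\Lambda)$ for almost all maximal ideals $\mathcal W$ of $\mathcal O_K$ (with $\mathrm{red}_{\mathcal W}$ the reduction modulo $\mathcal W$), one has $P\in\Lambda+N_{\mathrm{tor}}$. So the bound $d\geq e$ in the local to global principle for $\phi^e$ is sharp. -/

import Mathlib

open scoped Polynomial RatFunc

noncomputable section

/-! Twisted polynomials, Drinfeld `𝔽_q[t]`-modules, their Mordell-Weil modules and reductions.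
Throughout `A = Fq[X]` with `Fq` a finite field of `q` elements. -/

namespace Drinfeld

section Twisted

variable (Fq : Type*) [Field Fq] [Fintype Fq]

/-- The `q`-Frobenius `x ↦ x ^ q` of an `Fq[X]`-algebra, as a ring homomorphism. -/
def frob (R : Type*) [CommRing R] [Algebra Fq[X] R] : R →+* R :=
  letI : Algebra Fq R := Algebra.compHom R (algebraMap Fq Fq[X])
  (FiniteField.frobeniusAlgHom Fq R).toRingHom

theorem frob_apply {R : Type*} [CommRing R] [Algebra Fq[X] R] (x : R) :
    frob Fq R x = x ^ Fintype.card Fq := rfl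

theorem frob_iterate {R : Type*} [CommRing R] [Algebra Fq[X] R] (n : ℕ) (x : R) :
    (frob Fq R ^ n) x = x ^ Fintype.card Fq ^ n := by
  induction n generalizing x with
  | zero => simp
  | succ n ih => rw [pow_succ', RingHom.mul_def, RingHom.comp_apply, ih, frob_apply, ← pow_mul,
      pow_succ]

/-- The action of `Multiplicative ℕ` on `R` through powers of the `q`-Frobenius: the generator
acts as `x ↦ x ^ q`, so that `τ u = u ^ q τ` in the associated skew polynomial ring. -/
@[reducible] def frobAction (R : Type*) [CommRing R] [Algebra Fq[X] R] :
    MulSemiringAction (Multiplicative ℕ) R where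
  smul n x := (frob Fq R ^ n.toAdd) x
  one_smul x := rfl
  mul_smul m n x := by
    change (frob Fq R ^ (m.toAdd + n.toAdd)) x = _
    rw [pow_add]; rfl
  smul_zero n := map_zero _
  smul_add n := map_add _
  smul_one n := map_one _
  smul_mul n := map_mul _

/-- The twisted polynomial ring `R{τ}`, with `τ u = u ^ q τ`. -/
def TwistedPolynomial (R : Type*) [CommRing R] [Algebra Fq[X] R] : Type _ :=
  SkewPolynomial R

variable {R S : Type*} [CommRing R] [Algebra Fq[X] R] [CommRing S] [Algebra Fq[X] S]

instance : Ring (TwistedPolynomial Fq R) :=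
  letI := frobAction Fq R
  inferInstanceAs (Ring (SkewPolynomial R))

namespace TwistedPolynomial

/-- The twisted monomial `r τ^n`. -/
def monomial (n : ℕ) (r : R) : TwistedPolynomial Fq R := SkewPolynomial.monomial n r

variable {Fq}

/-- The coefficient of `τ^n`. -/
def coeff (f : TwistedPolynomial Fq R) (n : ℕ) : R := SkewPolynomial.coeff f n

/-- The degree in `τ` (`0` for the zero polynomial). -/
def natDegree (f : TwistedPolynomial Fq R) : ℕ := (SkewPolynomial.support f).sup id

theorem monomial_mul_monomial (m n : ℕ) (r s : R) :
    monomial Fq m r * monomial Fq n s = monomial Fq (m + n) (r * s ^ Fintype.card Fq ^ m) := by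
  let _ := frobAction Fq R
  rw [← frob_iterate]
  exact SkewMonoidAlgebra.single_mul_single

variable (Fq R) in
/-- Evaluation of twisted polynomials: `∑ aᵢ τ^i` acts on `R` as `x ↦ ∑ aᵢ x ^ (q ^ i)`. -/
def evalHom : TwistedPolynomial Fq R →+* AddMonoid.End R :=
  letI := frobAction Fq R
  SkewMonoidAlgebra.liftNCRingHom (Module.toAddMonoidEnd R R)
    (DistribMulAction.toAddMonoidEnd (Multiplicative ℕ) R) (by
      intro x y
      ext z
      exact (smul_mul' y x z).symm)

theorem evalHom_monomial (n : ℕ) (r x : R) :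
    evalHom Fq R (monomial Fq n r) x = r * x ^ Fintype.card Fq ^ n := by
  let _ := frobAction Fq R
  rw [← frob_iterate]
  exact DFunLike.congr_fun (SkewMonoidAlgebra.liftNC_single
    ((Module.toAddMonoidEnd R R : R →+* AddMonoid.End R) : R →+ AddMonoid.End R)
    (DistribMulAction.toAddMonoidEnd (Multiplicative ℕ) R) (Multiplicative.ofAdd n) r) x

theorem induction {p : TwistedPolynomial Fq R → Prop} (f : TwistedPolynomial Fq R)
    (h0 : p 0) (h : ∀ n r g, p g → p (monomial Fq n r + g)) : p f :=
  SkewPolynomial.induction (motive := p) f h0 fun n r g _ _ hg => h n r g hg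

/-- The homomorphism `R{τ} → S{τ}` applying a homomorphism of `A`-algebras to the coefficients. -/
def map (f : R →ₐ[Fq[X]] S) : TwistedPolynomial Fq R →+* TwistedPolynomial Fq S :=
  letI := frobAction Fq R
  SkewMonoidAlgebra.liftNCRingHom
    (R := TwistedPolynomial Fq S)
    { toFun := fun r => monomial Fq 0 (f r)
      map_one' := by rw [map_one]; rfl
      map_mul' := fun a b => by rw [monomial_mul_monomial]; simp
      map_zero' := by rw [map_zero]; exact SkewPolynomial.monomial_zero_right 0
      map_add' := fun a b => by rw [map_add]; exact SkewPolynomial.monomial_add 0 _ _ }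
    { toFun := fun n => monomial Fq n.toAdd 1
      map_one' := rfl
      map_mul' := fun m n => by rw [monomial_mul_monomial]; simp }
    (by
      intro x y
      change monomial Fq 0 (f ((frob Fq R ^ y.toAdd) x)) * monomial Fq y.toAdd 1
        = monomial Fq y.toAdd 1 * monomial Fq 0 (f x)
      rw [frob_iterate, monomial_mul_monomial, monomial_mul_monomial]
      simp)

theorem map_monomial (f : R →ₐ[Fq[X]] S) (n : ℕ) (r : R) :
    map f (monomial Fq n r) = monomial Fq n (f r) := by
  let _ := frobAction Fq R
  have h : map f (monomial Fq n r) = monomial Fq 0 (f r) * monomial Fq n 1 :=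
    SkewMonoidAlgebra.liftNC_single _ _ (Multiplicative.ofAdd n) r
  rw [h, monomial_mul_monomial]
  simp

theorem evalHom_map (f : R →ₐ[Fq[X]] S) (g : TwistedPolynomial Fq R) (x : R) :
    f (evalHom Fq R g x) = evalHom Fq S (map f g) (f x) := by
  induction g using induction with
  | h0 => rw [map_zero, map_zero, map_zero]; exact map_zero f
  | h n r g ih =>
    rw [map_add, map_add, map_add]
    change f (evalHom Fq R (monomial Fq n r) x + evalHom Fq R g x) =
      evalHom Fq S (map f (monomial Fq n r)) (f x) + evalHom Fq S (map f g) (f x)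
    rw [map_add, ih, map_monomial, evalHom_monomial, evalHom_monomial]
    simp

theorem coeff_add (f g : TwistedPolynomial Fq R) (n : ℕ) :
    (f + g).coeff n = f.coeff n + g.coeff n :=
  SkewPolynomial.coeff_add f g n

theorem coeff_monomial (m n : ℕ) (r : R) :
    (monomial Fq m r).coeff n = if m = n then r else 0 :=
  SkewPolynomial.coeff_monomial

theorem coeff_map (f : R →ₐ[Fq[X]] S) (g : TwistedPolynomial Fq R) (n : ℕ) :
    (map f g).coeff n = f (g.coeff n) := by
  induction g using induction with
  | h0 => rw [map_zero]; exact (map_zero f).symm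
  | h m r g ih =>
    rw [map_add, coeff_add, coeff_add, map_monomial, map_add, ih, coeff_monomial, coeff_monomial]
    split_ifs <;> simp

end TwistedPolynomial

end Twisted

open TwistedPolynomial

/-- An `Fq`-algebra homomorphism `φ : A → R{τ}`, `a ↦ φ_a`, such that the constant coefficient of
`φ_a` is the image of `a` in `R`. (The scalars `c ∈ Fq` are the constants `c τ^0` of `R{τ}`.) -/
structure TauAction (Fq : Type*) [Field Fq] [Fintype Fq] (R : Type*) [CommRing R]
    [Algebra Fq[X] R] where
  toRingHom : Fq[X] →+* TwistedPolynomial Fq R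
  map_C : ∀ c : Fq, toRingHom (Polynomial.C c) = monomial Fq 0 (algebraMap Fq[X] R (Polynomial.C c))
  coeff_zero : ∀ a : Fq[X], (toRingHom a).coeff 0 = algebraMap Fq[X] R a

namespace TauAction

variable {Fq : Type*} [Field Fq] [Fintype Fq]
variable {R S : Type*} [CommRing R] [Algebra Fq[X] R] [CommRing S] [Algebra Fq[X] S]

/-- `φ` is a Drinfeld module: `φ_a ≠ ι(a) τ^0` for some `a`. -/
def IsDrinfeldModule (φ : TauAction Fq R) : Prop :=
  ∃ a : Fq[X], φ.toRingHom a ≠ monomial Fq 0 (algebraMap Fq[X] R a)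

/-- `φ` has rank `d`: `deg_τ φ_a = d * deg a` for all `a ≠ 0`. -/
def HasRank (φ : TauAction Fq R) (d : ℕ) : Prop :=
  ∀ a : Fq[X], a ≠ 0 → (φ.toRingHom a).natDegree = d * a.natDegree

/-- Apply a homomorphism of `A`-algebras to all coefficients (base change, reduction). -/
def map (φ : TauAction Fq R) (f : R →ₐ[Fq[X]] S) : TauAction Fq S where
  toRingHom := (TwistedPolynomial.map f).comp φ.toRingHom
  map_C c := by
    rw [RingHom.comp_apply, φ.map_C, map_monomial, AlgHom.commutes]
  coeff_zero a := by
    rw [RingHom.comp_apply, coeff_map, φ.coeff_zero, AlgHom.commutes]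

/-- Every endomorphism of `φ` (an element of `R{τ}` commuting with all `φ_a`) is one of the
`φ_a`, that is, `End(φ) = A`. -/
def EndEqA (φ : TauAction Fq R) : Prop :=
  ∀ f : TwistedPolynomial Fq R, (∀ a : Fq[X], f * φ.toRingHom a = φ.toRingHom a * f) →
    ∃ a : Fq[X], f = φ.toRingHom a

/-- The Mordell-Weil module `φ(R)`: the additive group of `R`, on which `a ∈ A` acts by evaluating
`φ_a`. -/
def Points (_φ : TauAction Fq R) : Type _ := R

instance (φ : TauAction Fq R) : AddCommGroup φ.Points := inferInstanceAs (AddCommGroup R)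

instance (φ : TauAction Fq R) : Module Fq[X] φ.Points :=
  letI : Module (AddMonoid.End R) φ.Points := inferInstanceAs (Module (AddMonoid.End R) R)
  Module.compHom φ.Points ((evalHom Fq R).comp φ.toRingHom)

theorem smul_def (φ : TauAction Fq R) (a : Fq[X]) (x : φ.Points) :
    a • x = evalHom Fq R (φ.toRingHom a) x := rfl

/-- The homomorphism `φ(R) → φ^f(S)` of `A`-modules induced by `f : R → S`. -/
def pointsMap (φ : TauAction Fq R) (f : R →ₐ[Fq[X]] S) : φ.Points →ₗ[Fq[X]] (φ.map f).Points where
  toFun x := f x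
  map_add' x y := map_add f x y
  map_smul' a x := evalHom_map f (φ.toRingHom a) x

/-- For a column `P` of `e` points of `φ`, the column `M P`, where `M` is an `e × e` matrix over
`A`. -/
def matMul {φ : TauAction Fq R} {e : ℕ} (M : Matrix (Fin e) (Fin e) Fq[X])
    (P : Fin e → φ.Points) : Fin e → φ.Points :=
  fun i => ∑ j, M i j • P j

/-- The `A`-submodule `{M P : tr M = 0}` of `φ(R)^e`. -/
def traceZeroSubmodule {φ : TauAction Fq R} {e : ℕ} (P : Fin e → φ.Points) :
    Submodule Fq[X] (Fin e → φ.Points) where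
  carrier := {Q | ∃ M : Matrix (Fin e) (Fin e) Fq[X], M.trace = 0 ∧ Q = matMul M P}
  zero_mem' := ⟨0, by simp, by ext i; simp [matMul]⟩
  add_mem' := by
    rintro _ _ ⟨M, hM, rfl⟩ ⟨N, hN, rfl⟩
    refine ⟨M + N, by simp [hM, hN], ?_⟩
    ext i
    simp [matMul, add_smul, Finset.sum_add_distrib]
  smul_mem' := by
    rintro a _ ⟨M, hM, rfl⟩
    refine ⟨a • M, by simp [hM], ?_⟩
    ext i
    simp [matMul, mul_smul, Finset.smul_sum]

/-- The submodule `N^e` of `φ(R)^e`. -/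
def powSubmodule {φ : TauAction Fq R} (N : Submodule Fq[X] φ.Points) (e : ℕ) :
    Submodule Fq[X] (Fin e → φ.Points) :=
  Submodule.pi Set.univ fun _ => N

end TauAction

open TauAction

section Global

variable {Fq : Type*} [Field Fq] [Fintype Fq] {O : Type*} [CommRing O] [Algebra Fq[X] O]
  {K : Type*} [Field K] [Algebra Fq[X] K] [Algebra O K] [IsScalarTower Fq[X] O K]
  [FaithfulSMul O K]

/-! Here `O` is a subring of the field `K`; it will be the ring of integers `O_K`. A prime at
which the reduction is taken is a maximal ideal `W` of `O`. -/

/-- The inclusion of the localization `O_{K,W}` in `K`. -/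
def locToField (K : Type*) [Field K] [Algebra Fq[X] K] [Algebra O K] [IsScalarTower Fq[X] O K]
    [FaithfulSMul O K] (W : Ideal O) [W.IsPrime] :
    Localization.AtPrime W →ₐ[Fq[X]] K :=
  IsLocalization.liftAlgHom (M := W.primeCompl) (f := IsScalarTower.toAlgHom Fq[X] O K) (by
    intro y
    refine isUnit_iff_ne_zero.mpr fun h => y.2 ?_
    have h0 : (y : O) = 0 := FaithfulSMul.algebraMap_injective O K (h.trans (map_zero _).symm)
    rw [h0]
    exact W.zero_mem)

/-- The reduction map `O_{K,W} → O_{K,W} / W O_{K,W}` to the residue field at `W`, which is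
`O_K / W` for `W` maximal. -/
def locToResidue (W : Ideal O) [W.IsPrime] :
    Localization.AtPrime W →ₐ[Fq[X]] W.ResidueField :=
  IsScalarTower.toAlgHom Fq[X] (Localization.AtPrime W) W.ResidueField

/-- The reduction map `O_K → O_K / W`. -/
def reduceMod (W : Ideal O) :
    O →ₐ[Fq[X]] O ⧸ W :=
  Ideal.Quotient.mkₐ Fq[X] W

/-- The reduction map `φ(O_K) → φ^W(O_K / W)`, coordinate by coordinate on `φ(O_K)^e`, where
`φ^W` is obtained from `φ` by reducing all coefficients modulo `W`. -/
def red (φ : TauAction Fq O) (e : ℕ) (W : Ideal O) :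
    (Fin e → φ.Points) →ₗ[Fq[X]] (Fin e → (φ.map (reduceMod W)).Points) :=
  (φ.pointsMap (reduceMod W)).compLeft (Fin e)

/-- `φ₁ = α φ α⁻¹` has `W`-integral coefficients, and its reduction is a Drinfeld module of
rank `d` over the residue field. The prime `W` is good for the Drinfeld module `φ` of rank `d`
if this holds for some `α` (which determines `φ₁`). -/
structure IsGoodModel (φ : TauAction Fq O) (d : ℕ)
    (W : Ideal O) [W.IsPrime] (α : K)
    (φ₁ : TauAction Fq (Localization.AtPrime W)) : Prop where
  ne_zero : α ≠ 0
  conj : ∀ a : Fq[X], (φ₁.map (locToField K W)).toRingHom a * monomial Fq 0 α =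
    monomial Fq 0 α * (φ.map (IsScalarTower.toAlgHom Fq[X] O K)).toRingHom a
  isDrinfeldModule : (φ₁.map (locToResidue W)).IsDrinfeldModule
  hasRank : (φ₁.map (locToResidue W)).HasRank d

/-- For a good model `φ₁ = α φ α⁻¹` of `φ` at `W`: the point `x ∈ φ(O_K)` corresponds to the point
`α x` of `φ₁`, it is `W`-integral, and its reduction in `φ₁^W(O_K / W)` is `y`. For `α = 1` this
says that `y` is `x` modulo `W`. -/
def ReducesTo (φ : TauAction Fq O) (W : Ideal O)
    [W.IsPrime] (α : K) (φ₁ : TauAction Fq (Localization.AtPrime W))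
    (x : φ.Points) (y : (φ₁.map (locToResidue W)).Points) : Prop :=
  ∃ z : φ₁.Points, locToField (Fq := Fq) K W z = α * algebraMap O K x ∧
    φ₁.pointsMap (locToResidue W) z = y

variable (K) in
/-- `red_W(P) ∈ red_W(Λ)` for every prime `W` of good reduction of the Drinfeld module `φ` of
rank `d` (and every good model of `φ` at `W`). -/
def LocallyInAtGoodPrimes (φ : TauAction Fq O) (d : ℕ) {e : ℕ}
    (P : Fin e → φ.Points) (Λ : Submodule Fq[X] (Fin e → φ.Points)) : Prop :=
  ∀ (W : Ideal O) [W.IsMaximal] (α : K)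
    (φ₁ : TauAction Fq (Localization.AtPrime W)), IsGoodModel φ d W α φ₁ →
    ∃ y : Fin e → (φ₁.map (locToResidue W)).Points,
      (∀ i, ReducesTo φ W α φ₁ (P i) (y i)) ∧
      ∃ Q ∈ Λ, ∀ i, ReducesTo φ W α φ₁ (Q i) (y i)

/-- The local to global principle for the `t`-module `φ^e`: for every finitely generated
`N₁ ⊆ φ(O_K)`, every submodule `Λ` of `N = N₁^e` and every `P ∈ N`, if `red_W(P) ∈ red_W(Λ)` for
almost all maximal ideals `W` of `O_K`, then `P ∈ Λ + N_tor`. -/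
def LocalGlobalPrinciple (φ : TauAction Fq O) (e : ℕ) : Prop :=
  ∀ N₁ : Submodule Fq[X] φ.Points, N₁.FG →
  ∀ Λ : Submodule Fq[X] (Fin e → φ.Points), Λ ≤ powSubmodule N₁ e →
  ∀ P ∈ powSubmodule N₁ e,
    (∀ᶠ W : MaximalSpectrum O in Filter.cofinite,
      red φ e W.asIdeal P ∈ Λ.map (red φ e W.asIdeal)) →
    P ∈ Λ ⊔ (powSubmodule N₁ e ⊓ Submodule.torsion Fq[X] (Fin e → φ.Points))

end Global

end Drinfeld

end

set_option linter.unusedSectionVars false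

/-! The number `d` enters through torsion. If `φ` has rank `d` over a finite field `k`, then for
nonconstant `ℓ` the map `φ_ℓ` is an ordinary polynomial of degree `q ^ (d * deg ℓ)`, so `φ(k)[ℓ]`
has at most `|A/ℓ|^d` elements. Hence no `d + 1` points of `φ(k)` can be independent modulo `ℓ`:
they satisfy a relation whose coefficients are not all divisible by `ℓ` (`exists_relation_not_dvd`).

Let `p` be a column of `d + 1` points of `φ(k)`. The traces of the matrices killing `p` form an
ideal of `A`. A relation with some coefficient prime to `ℓ`, put into the right row, has trace
outside `(ℓ)`, so the ideal lies in no maximal ideal and is all of `A`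
(`exists_matMul_eq_zero_trace_eq`). For an invertible matrix `C`, choose `B` with `B p = 0` and `tr
B = tr C`. Then `M = 1 - C⁻¹ B` fixes `p` and `tr (C M) = 0`. So the reduction of `P` always lies in
that of `Λ_C = {M P : tr (C M) = 0}`.

Globally, `P = M P + torsion` with independent entries forces `M = 1`, so membership of `P` in `Λ_C
+ torsion` means `tr C = 0` (`mem_twistedTraceZeroSubmodule_sup_torsion_iff`). The choice `C = 1`
has trace `d + 1` and gives the trace-zero module. If the characteristic divides `d + 1`, a product
of two transvections has trace `1` and serves instead.

Three further facts are needed. Independent points come from a valuation at infinity, under which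
`t` acts on large elements roughly as `x ↦ x ^ (q ^ d)` (`linearIndependent_of_growth`). At a good
model the scalar `α` is automatically `W`-integral, so that `x ↦ α x mod W` is an `A`-linear map to
which the local argument applies (`IsGoodModel.exists_locToField_eq`). Finally, residue fields are
finite and a nonzero element lies in finitely many maximal ideals. -/

noncomputable section

namespace Drinfeld

/-! ### Coefficients, degrees and zeros of twisted polynomials -/

namespace TwistedPolynomial

section

variable {Fq : Type*} [Field Fq] [Fintype Fq] {R : Type*} [CommRing R] [Algebra Fq[X] R]

theorem coeff_zero_apply (n : ℕ) : (0 : TwistedPolynomial Fq R).coeff n = 0 := rfl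

theorem ext_coeff {f g : TwistedPolynomial Fq R} (h : ∀ n, f.coeff n = g.coeff n) : f = g :=
  SkewPolynomial.ext h

theorem coeff_eq_zero_of_natDegree_lt {f : TwistedPolynomial Fq R} {n : ℕ}
    (h : f.natDegree < n) : f.coeff n = 0 := by
  by_contra hn
  exact absurd (Finset.le_sup (f := id) (SkewPolynomial.mem_support_iff.mpr hn)) (not_le.mpr h)

theorem natDegree_le_of_coeff_eq_zero {f : TwistedPolynomial Fq R} {n : ℕ}
    (h : ∀ m, n < m → f.coeff m = 0) : f.natDegree ≤ n :=
  Finset.sup_le fun m hm => not_lt.mp fun hnm => SkewPolynomial.mem_support_iff.mp hm (h m hnm)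

theorem le_natDegree_of_coeff_ne_zero {f : TwistedPolynomial Fq R} {n : ℕ}
    (h : f.coeff n ≠ 0) : n ≤ f.natDegree :=
  not_lt.mp fun hn => h (coeff_eq_zero_of_natDegree_lt hn)

theorem coeff_natDegree_ne_zero {f : TwistedPolynomial Fq R} (h : f.natDegree ≠ 0) :
    f.coeff f.natDegree ≠ 0 := by
  have hne : (SkewPolynomial.support f).Nonempty := by
    rw [Finset.nonempty_iff_ne_empty]
    intro h0
    exact h (by rw [natDegree, h0]; rfl)
  obtain ⟨i, hi, hi'⟩ := Finset.exists_mem_eq_sup _ hne id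
  have : f.natDegree = i := hi'
  rw [this]
  exact SkewPolynomial.mem_support_iff.mp hi

theorem coeff_monomial_mul (m n : ℕ) (r : R) (f : TwistedPolynomial Fq R) :
    (monomial Fq m r * f).coeff n =
      if m ≤ n then r * f.coeff (n - m) ^ Fintype.card Fq ^ m else 0 := by
  induction f using induction with
  | h0 =>
    rw [mul_zero, coeff_zero_apply, coeff_zero_apply,
      zero_pow (pow_ne_zero _ Fintype.card_ne_zero), mul_zero, ite_self]
  | h k s g ih =>
    rw [mul_add, coeff_add, ih, monomial_mul_monomial, coeff_add, ← frob_iterate Fq m (_ + _),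
      map_add, coeff_monomial, coeff_monomial, frob_iterate, frob_iterate]
    by_cases h : m ≤ n
    · have h' : m + k = n ↔ k = n - m := by omega
      simp only [h, if_true, h']
      split_ifs <;> simp [mul_add, zero_pow]
    · have h' : m + k ≠ n := by omega
      simp [h, h']

theorem coeff_sum {ι : Type*} (s : Finset ι) (f : ι → TwistedPolynomial Fq R) (n : ℕ) :
    (∑ i ∈ s, f i).coeff n = ∑ i ∈ s, (f i).coeff n := by
  classical
  induction s using Finset.induction with
  | empty => rfl
  | insert a s ha ih => rw [Finset.sum_insert ha, Finset.sum_insert ha, coeff_add, ih]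

theorem eq_sum_monomial {f : TwistedPolynomial Fq R} {N : ℕ} (h : f.natDegree < N) :
    f = ∑ i ∈ Finset.range N, monomial Fq i (f.coeff i) := by
  apply ext_coeff
  intro n
  rw [coeff_sum]
  simp only [coeff_monomial, Finset.sum_ite_eq', Finset.mem_range]
  split_ifs with hn
  · rfl
  · exact coeff_eq_zero_of_natDegree_lt (h.trans_le (not_lt.mp hn))

theorem evalHom_eq_sum {f : TwistedPolynomial Fq R} {N : ℕ} (h : f.natDegree < N) (x : R) :
    evalHom Fq R f x = ∑ i ∈ Finset.range N, f.coeff i * x ^ Fintype.card Fq ^ i := by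
  conv_lhs => rw [eq_sum_monomial h, map_sum]
  have : ∀ s : Finset ℕ, (∑ i ∈ s, evalHom Fq R (monomial Fq i (f.coeff i))) x =
      ∑ i ∈ s, evalHom Fq R (monomial Fq i (f.coeff i)) x := fun s =>
    AddMonoidHom.finsetSum_apply _ _ _
  rw [this]
  simp only [evalHom_monomial]

theorem coeff_mul_of_natDegree_le {f g : TwistedPolynomial Fq R} {m n : ℕ}
    (hf : f.natDegree ≤ m) (hg : g.natDegree ≤ n) :
    (f * g).coeff (m + n) = f.coeff m * g.coeff n ^ Fintype.card Fq ^ m := by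
  conv_lhs => rw [eq_sum_monomial (Nat.lt_succ_of_le hf), Finset.sum_mul, coeff_sum]
  simp only [coeff_monomial_mul]
  rw [Finset.sum_eq_single_of_mem m (Finset.self_mem_range_succ m)]
  · simp
  · intro i hi him
    rw [if_pos (by have := Finset.mem_range.mp hi; omega),
      coeff_eq_zero_of_natDegree_lt (f := g) (by have := Finset.mem_range.mp hi; omega),
      zero_pow (pow_ne_zero _ Fintype.card_ne_zero), mul_zero]

/-- Evaluation is that of the ordinary polynomial `∑ aᵢ x ^ (q ^ i)`. It is nonzero because the
exponents `q ^ i` are distinct, and its degree bounds its roots. -/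
theorem card_evalHom_eq_zero_le [IsDomain R] [Finite R] {f : TwistedPolynomial Fq R} {D : ℕ}
    (hD : f.natDegree ≤ D) (hf : f.coeff D ≠ 0) :
    Nat.card {x : R // evalHom Fq R f x = 0} ≤ Fintype.card Fq ^ D := by
  classical
  let p : R[X] := ∑ i ∈ Finset.range (D + 1),
    Polynomial.monomial (Fintype.card Fq ^ i) (f.coeff i)
  have hinj : Function.Injective fun i : ℕ => Fintype.card Fq ^ i :=
    Nat.pow_right_injective Fintype.one_lt_card
  have hcoeff : p.coeff (Fintype.card Fq ^ D) = f.coeff D := by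
    simp only [p, Polynomial.finsetSum_coeff, Polynomial.coeff_monomial]
    rw [Finset.sum_eq_single_of_mem D (Finset.self_mem_range_succ D)]
    · simp
    · intro i _ hi
      exact if_neg fun h => hi (hinj h)
  have hp : p ≠ 0 := fun h => hf (by rw [← hcoeff, h, Polynomial.coeff_zero])
  have hdeg : p.natDegree ≤ Fintype.card Fq ^ D := by
    apply Polynomial.natDegree_sum_le_of_forall_le
    intro i hi
    exact (Polynomial.natDegree_monomial_le _).trans
      (Nat.pow_le_pow_right Fintype.card_pos (by have := Finset.mem_range.mp hi; omega))
  have heval (x : R) : p.eval x = evalHom Fq R f x := by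
    rw [evalHom_eq_sum (Nat.lt_succ_of_le hD)]
    simp [p, Polynomial.eval_finsetSum]
  let e : {x : R // evalHom Fq R f x = 0} → p.roots.toFinset := fun x =>
    ⟨x.1, by rw [Multiset.mem_toFinset, Polynomial.mem_roots hp, Polynomial.IsRoot, heval]; exact x.2⟩
  have he : Function.Injective e := fun x y h => Subtype.ext (congrArg (fun z => z.1) h)
  calc _ ≤ Nat.card p.roots.toFinset := Nat.card_le_card_of_injective e he
    _ = p.roots.toFinset.card := Nat.card_eq_card_toFinset _ |>.trans (by rw [Finset.toFinset_coe])
    _ ≤ _ := (Multiset.toFinset_card_le _).trans ((Polynomial.card_roots' p).trans hdeg)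

end

end TwistedPolynomial

open TwistedPolynomial

/-! ### Rank and the size of torsion -/

namespace TauAction

variable {Fq : Type*} [Field Fq] [Fintype Fq]
variable {R S : Type*} [CommRing R] [Algebra Fq[X] R] [CommRing S] [Algebra Fq[X] S]

/-- In rank `0` every `φ_a` would be its constant coefficient `a`, which the definition of a
Drinfeld module excludes. -/
theorem HasRank.pos {φ : TauAction Fq R} {d : ℕ} (hd : φ.HasRank d) (hφ : φ.IsDrinfeldModule) :
    0 < d := by
  rw [Nat.pos_iff_ne_zero]
  rintro rfl
  obtain ⟨a, ha⟩ := hφ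
  refine ha (ext_coeff fun n => ?_)
  rw [coeff_monomial]
  split_ifs with hn
  · rw [← hn, φ.coeff_zero]
  · by_cases h0 : a = 0
    · rw [h0, map_zero, coeff_zero_apply]
    · exact coeff_eq_zero_of_natDegree_lt (by rw [hd a h0]; omega)

theorem natDegree_le {φ : TauAction Fq R} {d : ℕ} (hd : φ.HasRank d) (a : Fq[X]) :
    (φ.toRingHom a).natDegree ≤ d * a.natDegree := by
  by_cases h0 : a = 0
  · rw [h0, map_zero]; exact Nat.zero_le _
  · exact (hd a h0).le

theorem natDegree_X {φ : TauAction Fq R} {d : ℕ} (hd : φ.HasRank d) :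
    (φ.toRingHom Polynomial.X).natDegree = d := by
  rw [hd _ Polynomial.X_ne_zero, Polynomial.natDegree_X, mul_one]

theorem leadingCoeff_ne_zero {φ : TauAction Fq R} {d : ℕ} (hd : φ.HasRank d) (h0 : 0 < d) :
    (φ.toRingHom Polynomial.X).coeff d ≠ 0 := by
  have := coeff_natDegree_ne_zero (f := φ.toRingHom Polynomial.X)
  rw [natDegree_X hd] at this
  exact this h0.ne'

theorem coeff_X_pow_ne_zero [IsDomain R] {φ : TauAction Fq R} {d : ℕ}
    (hd : ∀ a, (φ.toRingHom a).natDegree ≤ d * a.natDegree)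
    (h : (φ.toRingHom Polynomial.X).coeff d ≠ 0) (k : ℕ) :
    (φ.toRingHom (Polynomial.X ^ k)).coeff (d * k) ≠ 0 := by
  induction k with
  | zero =>
    rw [pow_zero, mul_zero, φ.coeff_zero, map_one]
    exact one_ne_zero
  | succ k ih =>
    rw [pow_succ, map_mul, mul_add, mul_one, coeff_mul_of_natDegree_le]
    · exact mul_ne_zero ih (pow_ne_zero _ h)
    · exact (hd _).trans (by simp)
    · exact (hd _).trans (by simp)

/-- Over a domain the top coefficient of `φ_{t^k}` is a product of powers of that of `φ_t`, hence
nonzero, and lower terms of `a` cannot cancel it. So the rank can be tested at `t` alone, which is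
what reduction modulo a prime needs. -/
theorem hasRank_of_coeff_X_ne_zero [IsDomain R] {φ : TauAction Fq R} {d : ℕ} (h0 : 0 < d)
    (hd : ∀ a, (φ.toRingHom a).natDegree ≤ d * a.natDegree)
    (h : (φ.toRingHom Polynomial.X).coeff d ≠ 0) : φ.HasRank d := by
  intro a ha
  refine le_antisymm (hd a) (le_natDegree_of_coeff_ne_zero ?_)
  conv => enter [1, 1]; rw [a.as_sum_range_C_mul_X_pow]
  rw [map_sum, coeff_sum, Finset.sum_eq_single_of_mem _ (Finset.self_mem_range_succ _)]
  · rw [map_mul, φ.map_C, coeff_monomial_mul, if_pos (Nat.zero_le _)]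
    simp only [pow_zero, pow_one, Nat.sub_zero]
    refine mul_ne_zero ?_ (coeff_X_pow_ne_zero hd h _)
    have : IsUnit (Polynomial.C a.leadingCoeff) :=
      Polynomial.isUnit_C.mpr (Polynomial.leadingCoeff_ne_zero.mpr ha).isUnit
    exact (this.map (algebraMap Fq[X] R)).ne_zero
  · intro i hi hne
    refine coeff_eq_zero_of_natDegree_lt ((hd _).trans_lt (Nat.mul_lt_mul_of_pos_left ?_ h0))
    have := Finset.mem_range.mp hi
    exact (Polynomial.natDegree_C_mul_X_pow_le _ _).trans_lt (by omega)

theorem natDegree_map_le {φ : TauAction Fq R} {d : ℕ}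
    (hd : φ.HasRank d) (f : R →ₐ[Fq[X]] S) (a : Fq[X]) :
    ((φ.map f).toRingHom a).natDegree ≤ d * a.natDegree :=
  natDegree_le_of_coeff_eq_zero fun m hm => by
    change (TwistedPolynomial.map f (φ.toRingHom a)).coeff m = 0
    rw [coeff_map, coeff_eq_zero_of_natDegree_lt ((natDegree_le hd a).trans_lt hm), map_zero]

theorem HasRank.map [IsDomain S] {φ : TauAction Fq R} {d : ℕ} (hd : φ.HasRank d) (h0 : 0 < d)
    (f : R →ₐ[Fq[X]] S) (hf : f ((φ.toRingHom Polynomial.X).coeff d) ≠ 0) :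
    (φ.map f).HasRank d := by
  refine hasRank_of_coeff_X_ne_zero h0 (natDegree_map_le hd f) ?_
  change (TwistedPolynomial.map f (φ.toRingHom Polynomial.X)).coeff d ≠ 0
  rwa [coeff_map]

theorem card_torsion_le [IsDomain R] [Finite R] {φ : TauAction Fq R} {d : ℕ} (hd : φ.HasRank d)
    (h0 : 0 < d) {a : Fq[X]} (ha : 0 < a.natDegree) :
    Nat.card {x : φ.Points // a • x = 0} ≤ Fintype.card Fq ^ (d * a.natDegree) := by
  have hdeg := hd a (by rintro rfl; simp at ha)
  refine card_evalHom_eq_zero_le (R := R) hdeg.le ?_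
  rw [← hdeg]
  exact coeff_natDegree_ne_zero (by rw [hdeg]; positivity)

end TauAction

end Drinfeld

namespace Drinfeld

/-! ### Counting in finite modules and finite quotients -/

section Counting

variable {Fq : Type*} [Field Fq] [Fintype Fq]

theorem card_degreeLT (n : ℕ) :
    Nat.card (Polynomial.degreeLT Fq n) = Fintype.card Fq ^ n := by
  rw [Nat.card_congr (Polynomial.degreeLTEquiv Fq n).toEquiv, Nat.card_fun, Nat.card_fin,
    Nat.card_eq_fintype_card]

instance finite_degreeLT (n : ℕ) : Finite (Polynomial.degreeLT Fq n) :=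
  Finite.of_equiv _ (Polynomial.degreeLTEquiv Fq n).toEquiv.symm

theorem card_quotient_range_lsmul {A N : Type*} [CommRing A] [AddCommGroup N] [Module A N]
    [Finite N] (a : A) :
    Nat.card (N ⧸ LinearMap.range (LinearMap.lsmul A N a)) =
      Nat.card (LinearMap.ker (LinearMap.lsmul A N a)) := by
  have h1 := Submodule.card_eq_card_quotient_mul_card (LinearMap.range (LinearMap.lsmul A N a))
  have h2 := Submodule.card_eq_card_quotient_mul_card (LinearMap.ker (LinearMap.lsmul A N a))
  rw [Nat.card_congr (LinearMap.quotKerEquivRange (LinearMap.lsmul A N a)).toEquiv] at h2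
  have h3 : 0 < Nat.card (LinearMap.range (LinearMap.lsmul A N a)) := Nat.card_pos
  rw [h1, mul_comm] at h2
  exact Nat.eq_of_mul_eq_mul_right h3 h2

/-- If the `ℓ`-torsion of the finite module `V` has at most `|A/ℓ|^d` elements, then `d + 1`
elements of `V` satisfy a linear relation which is nontrivial modulo `ℓ`. -/
theorem exists_relation_not_dvd {V : Type*} [AddCommGroup V] [Module Fq[X] V] [Finite V]
    {d : ℕ} {ℓ : Fq[X]} (hℓ : 0 < ℓ.natDegree)
    (hV : Nat.card {x : V // ℓ • x = 0} ≤ Fintype.card Fq ^ (d * ℓ.natDegree))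
    (p : Fin (d + 1) → V) :
    ∃ r : Fin (d + 1) → Fq[X], ∑ j, r j • p j = 0 ∧ ∃ i, ¬ ℓ ∣ r i := by
  let N := Submodule.span Fq[X] (Set.range p)
  let q : Fin (d + 1) → N := fun i => ⟨p i, Submodule.subset_span ⟨i, rfl⟩⟩
  let T := LinearMap.range (LinearMap.lsmul Fq[X] N ℓ)
  have : Finite (N ⧸ T) := Finite.of_surjective _ T.mkQ_surjective
  -- Kernel and cokernel of multiplication by `ℓ` on the finite module `N` have equal size, and
  -- `N[ℓ]` lies in `V[ℓ]`.
  have hT : Nat.card (N ⧸ T) ≤ Fintype.card Fq ^ (d * ℓ.natDegree) := by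
    rw [card_quotient_range_lsmul]
    refine le_trans (Nat.card_le_card_of_injective
      (β := {x : V // ℓ • x = 0}) (fun x => ⟨x.1.1, congrArg Subtype.val x.2⟩) ?_) hV
    intro x y h
    have h' := congrArg Subtype.val h
    exact Subtype.ext (Subtype.ext h')
  -- Pigeonhole: there are `|A/ℓ|^(d+1)` coefficient vectors of degree below `deg ℓ`, but at most
  -- `|A/ℓ|^d` classes in `N / ℓN`.
  let f : (Fin (d + 1) → Polynomial.degreeLT Fq ℓ.natDegree) → N ⧸ T := fun c =>
    T.mkQ (∑ j, (c j).1 • q j)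
  have hf : ¬ Function.Injective f := by
    intro hinj
    have h := (Nat.card_le_card_of_injective f hinj).trans hT
    rw [Nat.card_fun, card_degreeLT, Nat.card_fin, ← pow_mul] at h
    have := (Nat.pow_le_pow_iff_right (Fintype.one_lt_card (α := Fq))).mp h
    nlinarith
  simp only [Function.Injective, not_forall] at hf
  obtain ⟨c, c', hcc, hne⟩ := hf
  have hmem : ∑ j, ((c j).1 - (c' j).1) • q j ∈ T := by
    have h := (Submodule.Quotient.eq T).mp hcc
    rw [← Finset.sum_sub_distrib] at h
    rwa [← Finset.sum_congr rfl fun j _ => sub_smul (c j).1 (c' j).1 (q j)] at h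
  obtain ⟨y, hy⟩ := hmem
  obtain ⟨b, hb⟩ := (Submodule.mem_span_range_iff_exists_fun Fq[X]).mp y.2
  obtain ⟨i, hi⟩ := Function.ne_iff.mp hne
  -- The difference of two colliding combinations is `ℓ y` with `y = ∑ b j • p j`. Subtracting `ℓ *
  -- b` makes the relation exact without changing it modulo `ℓ`.
  refine ⟨fun j => ((c j).1 - (c' j).1) - ℓ * b j, ?_, i, ?_⟩
  · have hy' := congrArg Subtype.val hy
    simp only [LinearMap.lsmul_apply, Submodule.coe_smul, Submodule.coe_sum, q] at hy'
    simp only [sub_smul _ (ℓ * _), Finset.sum_sub_distrib, mul_smul, ← Finset.smul_sum]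
    rw [hb, ← hy', sub_self]
  · intro hdvd
    have h1 : ℓ ∣ (c i).1 - (c' i).1 := (dvd_sub_left (dvd_mul_right ℓ (b i))).mp hdvd
    have h2 := Polynomial.mem_degreeLT.mp ((c i) - (c' i)).2
    have h3 : (c i).1 - (c' i).1 ≠ 0 := fun h => hi (Subtype.ext (sub_eq_zero.mp h))
    have h4 := Polynomial.natDegree_le_of_dvd h1 h3
    have h5 : ((c i).1 - (c' i).1).natDegree < ℓ.natDegree :=
      (Polynomial.natDegree_lt_iff_degree_lt h3).mpr h2
    omega

/-- If `B` is a torsion-free `A`-algebra of finite rank, then `B / aB` is finite for `a ≠ 0`. -/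
theorem finite_quotient_span_algebraMap {B : Type*} [CommRing B] [IsDomain B] [Algebra Fq[X] B]
    (hinj : Function.Injective (algebraMap Fq[X] B)) {n : ℕ}
    (hn : ∀ (m : ℕ) (v : Fin m → B), LinearIndependent Fq[X] v → m ≤ n) {a : Fq[X]} (ha : a ≠ 0) :
    Finite (B ⧸ Ideal.span {algebraMap Fq[X] B a}) := by
  by_contra hinf
  rw [not_finite_iff_infinite] at hinf
  -- One class more than `|A/a|^n`. Lifts of these span a free module of rank at most `n`, where
  -- coordinates modulo `a` already separate the classes. This needs only bounded rank, not that `B`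
  -- be finite over `A`.
  obtain ⟨g, hg⟩ : ∃ g : Fin (Fintype.card Fq ^ (a.natDegree * n) + 1) →
      B ⧸ Ideal.span {algebraMap Fq[X] B a}, Function.Injective g :=
    ⟨_, (Fin.valEmbedding.trans (Infinite.natEmbedding _)).injective⟩
  choose y hy using fun i => Ideal.Quotient.mk_surjective (g i)
  let N := Submodule.span Fq[X] (Set.range y)
  have : Module.IsTorsionFree Fq[X] B := by
    have : FaithfulSMul Fq[X] B := (faithfulSMul_iff_algebraMap_injective _ _).mpr hinj
    infer_instance
  have : Module.Finite Fq[X] N := Module.Finite.span_of_finite _ (Set.finite_range y)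
  let b := Module.finBasis Fq[X] N
  have hr := hn _ _ (b.linearIndependent.map' N.subtype N.ker_subtype)
  let z : Fin _ → N := fun i => ⟨y i, Submodule.subset_span ⟨i, rfl⟩⟩
  let f : Fin (Fintype.card Fq ^ (a.natDegree * n) + 1) →
      (Fin (Module.finrank Fq[X] N) → Polynomial.degreeLT Fq a.natDegree) := fun i j =>
    ⟨b.repr (z i) j % a, by
      rw [Polynomial.mem_degreeLT, ← Polynomial.degree_eq_natDegree ha]
      exact EuclideanDomain.mod_lt _ ha⟩
  have hf : Function.Injective f := by
    intro i k hik
    apply hg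
    rw [← hy, ← hy, Ideal.Quotient.eq, Ideal.mem_span_singleton]
    have hdvd (j) : a ∣ b.repr (z i - z k) j := by
      have := congrArg Subtype.val (congrFun hik j)
      rw [map_sub, Finsupp.sub_apply]
      change b.repr (z i) j % a = b.repr (z k) j % a at this
      rw [← EuclideanDomain.div_add_mod (b.repr (z i) j) a,
        ← EuclideanDomain.div_add_mod (b.repr (z k) j) a, this, add_sub_add_right_eq_sub, ← mul_sub]
      exact dvd_mul_right _ _
    choose c hc using hdvd
    have h := congrArg Subtype.val (b.sum_repr (z i - z k))
    simp only [hc, mul_smul, ← Finset.smul_sum] at h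
    refine ⟨((∑ j, c j • b j : N) : B), ?_⟩
    rw [← Algebra.smul_def]
    exact h.symm
  have h := Nat.card_le_card_of_injective f hf
  rw [Nat.card_fun, card_degreeLT, Nat.card_fin, Nat.card_fin, ← pow_mul] at h
  have := Nat.pow_le_pow_right (Fintype.card_pos (α := Fq)) (Nat.mul_le_mul_left a.natDegree hr)
  omega

end Counting

/-! ### Matrices annihilating or fixing a column of points -/

section Matrices

variable {Fq : Type*} [Field Fq] [Fintype Fq] {R : Type*} [CommRing R] [Algebra Fq[X] R]
  {φ : TauAction Fq R}

namespace TauAction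

theorem one_matMul {e : ℕ} (P : Fin e → φ.Points) : matMul 1 P = P := by
  ext i
  simp [matMul, Matrix.one_apply]

theorem matMul_zero {e : ℕ} (M : Matrix (Fin e) (Fin e) Fq[X]) :
    matMul M (0 : Fin e → φ.Points) = 0 := by
  ext i
  simp [matMul]

theorem sub_matMul {e : ℕ} (M N : Matrix (Fin e) (Fin e) Fq[X]) (P : Fin e → φ.Points) :
    matMul (M - N) P = matMul M P - matMul N P := by
  ext i
  simp [matMul, sub_smul]

theorem mul_matMul {e : ℕ} (M N : Matrix (Fin e) (Fin e) Fq[X]) (P : Fin e → φ.Points) :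
    matMul (M * N) P = matMul M (matMul N P) := by
  ext i
  simp only [matMul, Matrix.mul_apply, Finset.sum_smul, Finset.smul_sum, mul_smul]
  exact Finset.sum_comm

/-- The matrices annihilating the column `P`. -/
def annihilatingMatrices {e : ℕ} (P : Fin e → φ.Points) :
    Submodule Fq[X] (Matrix (Fin e) (Fin e) Fq[X]) where
  carrier := {B | matMul B P = 0}
  zero_mem' := by ext i; simp [matMul]
  add_mem' {B C} hB hC := by
    have h : matMul (B + C) P = matMul B P + matMul C P := by
      ext i
      simp [matMul, add_smul, Finset.sum_add_distrib]
    change matMul (B + C) P = 0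
    rw [h, show matMul B P = 0 from hB, show matMul C P = 0 from hC, add_zero]
  smul_mem' a B hB := by
    have h : matMul (a • B) P = a • matMul B P := by
      ext i
      simp [matMul, mul_smul, Finset.smul_sum]
    change matMul (a • B) P = 0
    rw [h, show matMul B P = 0 from hB, smul_zero]

theorem exists_matMul_eq_zero_trace_eq [IsDomain R] [Finite R] {d : ℕ} (h0 : 0 < d)
    (hd : φ.HasRank d) (p : Fin (d + 1) → φ.Points) (t : Fq[X]) :
    ∃ B : Matrix (Fin (d + 1)) (Fin (d + 1)) Fq[X], matMul B p = 0 ∧ B.trace = t := by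
  have : Finite φ.Points := inferInstanceAs (Finite R)
  let J : Ideal Fq[X] := (annihilatingMatrices p).map (Matrix.traceLinearMap (Fin (d + 1)) Fq[X] Fq[X])
  suffices hJ : J = ⊤ by
    have : t ∈ J := hJ ▸ Submodule.mem_top
    exact this
  by_contra hJ
  obtain ⟨m, hm, hJm⟩ := Ideal.exists_le_maximal J hJ
  obtain ⟨ℓ, rfl⟩ := IsPrincipalIdealRing.principal m
  have hℓ0 : ℓ ≠ 0 := by
    rintro rfl
    refine Ring.ne_bot_of_isMaximal_of_not_isField hm (Polynomial.not_isField Fq) ?_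
    simp
  have hℓ : 0 < ℓ.natDegree := by
    rw [Nat.pos_iff_ne_zero]
    intro h
    refine hm.ne_top (Ideal.span_singleton_eq_top.mpr ?_)
    rw [Polynomial.isUnit_iff_degree_eq_zero, Polynomial.degree_eq_natDegree hℓ0, h]
    rfl
  obtain ⟨r, hr, i, hi⟩ := exists_relation_not_dvd hℓ (card_torsion_le hd h0 hℓ) p
  -- The relation `r` is placed in row `i` of a zero matrix: this kills `p` and has trace `r i`,
  -- which would then lie in `(ℓ)`.
  refine hi (Ideal.mem_span_singleton.mp (hJm ⟨Matrix.updateRow 0 i r, ?_, ?_⟩))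
  · change matMul _ p = 0
    ext k
    by_cases hk : k = i
    · subst hk
      simpa [matMul] using hr
    · simp [matMul, Matrix.updateRow_ne hk]
  · rw [Matrix.traceLinearMap_apply, Matrix.trace, Finset.sum_eq_single i]
    · simp
    · intro k _ hk
      simp [Matrix.updateRow_ne hk]
    · simp

/-- Over a finite domain, a column of `d + 1` points of a Drinfeld module of rank `d` is fixed by
a matrix `M` with `tr (C M) = 0`. -/
theorem exists_matMul_eq_self [IsDomain R] [Finite R] {d : ℕ} (h0 : 0 < d)
    (hd : φ.HasRank d) (p : Fin (d + 1) → φ.Points)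
    {C : Matrix (Fin (d + 1)) (Fin (d + 1)) Fq[X]} (hC : IsUnit C) :
    ∃ M : Matrix (Fin (d + 1)) (Fin (d + 1)) Fq[X], (C * M).trace = 0 ∧ matMul M p = p := by
  obtain ⟨B, hB, ht⟩ := exists_matMul_eq_zero_trace_eq h0 hd p C.trace
  obtain ⟨D, hD⟩ := hC.exists_right_inv
  -- Since `C * D = 1`, one gets `C * (1 - D * B) = C - B`, of trace zero.
  refine ⟨1 - D * B, ?_, ?_⟩
  · rw [Matrix.mul_sub, ← Matrix.mul_assoc, hD, Matrix.mul_one, Matrix.one_mul, Matrix.trace_sub,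
      ht, sub_self]
  · rw [sub_matMul, one_matMul, mul_matMul, hB, matMul_zero, sub_zero]

end TauAction

end Matrices

end Drinfeld

namespace Drinfeld

/-! ### Finiteness of residue rings of the ring of integers -/

section Finiteness

variable {Fq : Type*} [Field Fq] [Fintype Fq]
  {K : Type*} [Field K] [Algebra Fq[X] K] [Algebra Fq⟮X⟯ K] [IsScalarTower Fq[X] Fq⟮X⟯ K]
  [FunctionField Fq K]

theorem le_finrank_of_linearIndependent {m : ℕ} (v : Fin m → FunctionField.ringOfIntegers Fq K)
    (hv : LinearIndependent Fq[X] v) : m ≤ Module.finrank Fq⟮X⟯ K := by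
  have h1 := hv.map' (FunctionField.ringOfIntegers Fq K).val.toLinearMap
    (LinearMap.ker_eq_bot.mpr Subtype.val_injective)
  have h2 := (LinearIndependent.iff_fractionRing Fq[X] Fq⟮X⟯).mp h1
  simpa using h2.fintype_card_le_finrank

theorem finite_quotient_span {a : Fq[X]} (ha : a ≠ 0) :
    Finite (FunctionField.ringOfIntegers Fq K ⧸
      Ideal.span {algebraMap Fq[X] (FunctionField.ringOfIntegers Fq K) a}) :=
  finite_quotient_span_algebraMap (FunctionField.ringOfIntegers.algebraMap_injective Fq K)
    (fun _ v hv => le_finrank_of_linearIndependent v hv) ha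

theorem exists_dvd_algebraMap {x : FunctionField.ringOfIntegers Fq K} (hx : x ≠ 0) :
    ∃ a : Fq[X], a ≠ 0 ∧ x ∣ algebraMap Fq[X] (FunctionField.ringOfIntegers Fq K) a := by
  have : FaithfulSMul Fq[X] (FunctionField.ringOfIntegers Fq K) :=
    (faithfulSMul_iff_algebraMap_injective _ _).mpr
      (FunctionField.ringOfIntegers.algebraMap_injective Fq K)
  have hint : IsIntegral Fq[X] x := IsIntegralClosure.isIntegral Fq[X] K x
  exact hint.isAlgebraic.exists_nonzero_dvd (mem_nonZeroDivisors_of_ne_zero hx)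

theorem finite_quotient_of_mem {I : Ideal (FunctionField.ringOfIntegers Fq K)}
    {x : FunctionField.ringOfIntegers Fq K} (hx : x ≠ 0) (hxI : x ∈ I) :
    Finite (FunctionField.ringOfIntegers Fq K ⧸ I) := by
  obtain ⟨a, ha, hdvd⟩ := exists_dvd_algebraMap hx
  have := finite_quotient_span (K := K) ha
  exact Finite.of_surjective _ (Ideal.Quotient.factor_surjective
    ((Ideal.span_singleton_le_iff_mem I).mpr (I.mem_of_dvd hdvd hxI)))

theorem finite_quotient_of_isMaximal (W : Ideal (FunctionField.ringOfIntegers Fq K))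
    [hW : W.IsMaximal] : Finite (FunctionField.ringOfIntegers Fq K ⧸ W) := by
  obtain ⟨x, hx, hx0⟩ := Submodule.exists_mem_ne_zero_of_ne_bot
    (Ring.ne_bot_of_isMaximal_of_not_isField hW (FunctionField.ringOfIntegers.not_isField Fq K))
  exact finite_quotient_of_mem hx0 hx

/-- These maximal ideals inject into the ideals of the finite ring obtained by dividing by `x`. -/
theorem finite_maximalSpectrum_mem {x : FunctionField.ringOfIntegers Fq K} (hx : x ≠ 0) :
    {W : MaximalSpectrum (FunctionField.ringOfIntegers Fq K) | x ∈ W.asIdeal}.Finite := by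
  have hfin := finite_quotient_of_mem hx (Ideal.mem_span_singleton_self x)
  have : Finite (Ideal (FunctionField.ringOfIntegers Fq K ⧸ Ideal.span {x})) :=
    Finite.of_injective _ (SetLike.coe_injective (A := Ideal _))
  refine Set.Finite.of_injOn
    (f := fun W => Ideal.map (Ideal.Quotient.mk (Ideal.span {x})) W.asIdeal)
    (t := Set.univ) (fun _ _ => Set.mem_univ _) ?_ Set.finite_univ
  intro W hW W' hW' h
  have key (V : MaximalSpectrum (FunctionField.ringOfIntegers Fq K)) (hV : x ∈ V.asIdeal) :
      Ideal.comap (Ideal.Quotient.mk (Ideal.span {x}))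
        (Ideal.map (Ideal.Quotient.mk (Ideal.span {x})) V.asIdeal) = V.asIdeal := by
    rw [Ideal.comap_map_of_surjective' _ Ideal.Quotient.mk_surjective, Ideal.mk_ker]
    exact sup_eq_left.mpr ((Ideal.span_singleton_le_iff_mem _).mpr hV)
  apply MaximalSpectrum.ext
  rw [← key W hW, ← key W' hW']
  exact congrArg _ h

end Finiteness

/-! ### Valuations that are large at `t` -/

section Valuations

variable {Fq : Type*} [Field Fq] [Fintype Fq]

/-- `t` is transcendental over `Fq`, so it misses the integral closure of `Fq` in `K`, and an
integrally closed subring can be enlarged to a valuation ring still avoiding a given outside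
element. -/
theorem exists_valuationSubring_X_notMem {K : Type*} [Field K] [Algebra Fq[X] K]
    (hinj : Function.Injective (algebraMap Fq[X] K)) :
    ∃ V : ValuationSubring K, algebraMap Fq[X] K Polynomial.X ∉ V := by
  let _ : Algebra Fq K := Algebra.compHom K (algebraMap Fq Fq[X])
  have : IsScalarTower Fq Fq[X] K := IsScalarTower.of_algebraMap_eq fun _ => rfl
  have hX : algebraMap Fq[X] K Polynomial.X ∉ (integralClosure Fq K).toSubring := by
    rintro ⟨p, hp, hp0⟩
    have h : Polynomial.aeval (algebraMap Fq[X] K Polynomial.X) p = algebraMap Fq[X] K p := by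
      rw [Polynomial.aeval_algebraMap_apply, Polynomial.aeval_X_left_apply]
    rw [← Polynomial.aeval_def, h, map_eq_zero_iff _ hinj] at hp0
    exact hp.ne_zero hp0
  have : IsIntegrallyClosedIn (integralClosure Fq K).toSubring K :=
    inferInstanceAs (IsIntegrallyClosedIn (integralClosure Fq K) K)
  obtain ⟨V, -, hV⟩ := Subring.exists_le_valuationSubring_of_isIntegrallyClosedIn hX
  exact ⟨V, hV⟩

variable {R : Type*} [CommRing R] [Algebra Fq[X] R]
  {Γ : Type*} [LinearOrderedCommGroupWithZero Γ] (w : Valuation R Γ)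

/-- Nonzero constants are roots of unity, and an ordered group has no torsion. -/
theorem valuation_algebraMap_C {c : Fq} (hc : c ≠ 0) :
    w (algebraMap Fq[X] R (Polynomial.C c)) = 1 := by
  have h : w (algebraMap Fq[X] R (Polynomial.C c)) ^ (Fintype.card Fq - 1) = 1 := by
    rw [← map_pow, ← map_pow, ← map_pow, FiniteField.pow_card_sub_one_eq_one c hc, map_one,
      map_one, map_one]
  exact (pow_eq_one_iff.mp h).resolve_right (by have := Fintype.one_lt_card (α := Fq); omega)

theorem valuation_algebraMap_C_le (c : Fq) :
    w (algebraMap Fq[X] R (Polynomial.C c)) ≤ 1 := by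
  by_cases hc : c = 0
  · simp [hc]
  · exact (valuation_algebraMap_C w hc).le

theorem valuation_sum_range_succ {f : ℕ → R} {m : ℕ} (h : ∀ i < m, w (f i) < w (f m)) :
    w (∑ i ∈ Finset.range (m + 1), f i) = w (f m) := by
  rcases Nat.eq_zero_or_pos m with rfl | hm
  · simp
  · rw [Finset.sum_range_succ_comm]
    refine w.map_add_eq_of_lt_left (w.map_sum_lt (ne_zero_of_lt (h 0 hm)) ?_)
    exact fun i hi => h i (Finset.mem_range.mp hi)

theorem valuation_sum_coeff_mul {y : ℕ → R} (hy : StrictMono fun i => w (y i)) {a : Fq[X]}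
    (ha : a ≠ 0) :
    w (∑ i ∈ Finset.range (a.natDegree + 1),
      algebraMap Fq[X] R (Polynomial.C (a.coeff i)) * y i) = w (y a.natDegree) := by
  have htop : w (algebraMap Fq[X] R (Polynomial.C (a.coeff a.natDegree)) * y a.natDegree) =
      w (y a.natDegree) := by
    rw [map_mul, Polynomial.coeff_natDegree,
      valuation_algebraMap_C w (Polynomial.leadingCoeff_ne_zero.mpr ha), one_mul]
  rw [valuation_sum_range_succ, htop]
  intro i hi
  rw [htop, map_mul]
  exact (mul_le_of_le_one_left' (valuation_algebraMap_C_le w _)).trans_lt (hy hi)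

variable {w} (hw : 1 < w (algebraMap Fq[X] R Polynomial.X))

include hw in
theorem valuation_algebraMap {a : Fq[X]} (ha : a ≠ 0) :
    w (algebraMap Fq[X] R a) = w (algebraMap Fq[X] R Polynomial.X) ^ a.natDegree := by
  have hy : StrictMono fun i => w (algebraMap Fq[X] R Polynomial.X ^ i) := by
    simp only [map_pow]
    exact pow_right_strictMono₀ hw
  rw [← map_pow, ← valuation_sum_coeff_mul w hy ha]
  conv_lhs => rw [a.as_sum_range_C_mul_X_pow]
  simp

include hw in
-- Were `w x` larger than the valuations of all lower coefficients of an integral equation, its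
-- leading term would dominate. This replaces any assumption that the value group is archimedean.
theorem exists_valuation_le_pow {x : R} (hx : IsIntegral Fq[X] x) :
    ∃ N : ℕ, w x ≤ w (algebraMap Fq[X] R Polynomial.X) ^ N := by
  obtain ⟨p, hp, hpx⟩ := hx
  set N := (Finset.range p.natDegree).sup fun i => (p.coeff i).natDegree
  refine ⟨N, not_lt.mp fun hlt => ?_⟩
  have h1 : 1 < w x := (one_le_pow₀ hw.le).trans_lt hlt
  rw [hp.as_sum] at hpx
  simp only [Polynomial.eval₂_add, Polynomial.eval₂_pow, Polynomial.eval₂_X,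
    Polynomial.eval₂_finsetSum, Polynomial.eval₂_mul, Polynomial.eval₂_C] at hpx
  have h2 : w (x ^ p.natDegree) < w x ^ p.natDegree := by
    rw [eq_neg_of_add_eq_zero_left hpx, w.map_neg]
    refine w.map_sum_lt (pow_ne_zero _ (ne_zero_of_lt h1)) fun i hi => ?_
    have hcoeff : w (algebraMap Fq[X] R (p.coeff i)) < w x := by
      refine lt_of_le_of_lt ?_ hlt
      by_cases h0 : p.coeff i = 0
      · simp [h0]
      · rw [valuation_algebraMap hw h0]
        exact pow_le_pow_right₀ hw.le (Finset.le_sup (f := fun i => (p.coeff i).natDegree) hi)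
    rw [map_mul, map_pow]
    calc _ < w x * w x ^ i := mul_lt_mul_of_pos_right hcoeff (pow_pos (zero_lt_one.trans h1) _)
      _ = w x ^ (i + 1) := (pow_succ' _ _).symm
      _ ≤ _ := pow_le_pow_right₀ h1.le (Finset.mem_range.mp hi)
  rw [map_pow] at h2
  exact lt_irrefl _ h2

theorem eq_zero_of_sum_eq_zero {ι : Type*} [Fintype ι] {f : ι → R} (S : Set ι)
    (hS : ∀ i ∉ S, f i = 0) (h0 : ∀ i ∈ S, w (f i) ≠ 0)
    (hne : ∀ i ∈ S, ∀ j ∈ S, i ≠ j → w (f i) ≠ w (f j)) (hsum : ∑ i, f i = 0) : S = ∅ := by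
  classical
  by_contra hempty
  obtain ⟨i, hi, hmax⟩ := Set.exists_max_image S (fun i => w (f i)) (Set.toFinite S)
    (Set.nonempty_iff_ne_empty.mpr hempty)
  rw [← Finset.add_sum_erase _ _ (Finset.mem_univ i)] at hsum
  have h : w (f i) < w (f i) := by
    conv_lhs => rw [eq_neg_of_add_eq_zero_left hsum, w.map_neg]
    refine w.map_sum_lt (h0 i hi) fun j hj => ?_
    by_cases hjS : j ∈ S
    · exact lt_of_le_of_ne (hmax j hjS) (hne j hjS i hi (Finset.ne_of_mem_erase hj))
    · rw [hS j hjS, map_zero]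
      exact zero_lt_iff.mpr (h0 i hi)
  exact lt_irrefl _ h

end Valuations

end Drinfeld

namespace Drinfeld

open TwistedPolynomial

namespace TauAction

/-! ### Growth at infinity and independent points -/

section Growth

variable {Fq : Type*} [Field Fq] [Fintype Fq] {R : Type*} [CommRing R] [Algebra Fq[X] R]
  {Γ : Type*} [LinearOrderedCommGroupWithZero Γ] {w : Valuation R Γ}

/-- The element of `R` underlying a point. -/
def toRing (φ : TauAction Fq R) : φ.Points →+ R := AddMonoidHom.id R

theorem C_smul (φ : TauAction Fq R) (c : Fq) (x : φ.Points) :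
    φ.toRing (Polynomial.C c • x) = algebraMap Fq[X] R (Polynomial.C c) * φ.toRing x := by
  rw [smul_def, φ.map_C]
  refine (evalHom_monomial 0 _ (φ.toRing x)).trans ?_
  rw [pow_zero, pow_one]

theorem smul_eq_sum (φ : TauAction Fq R) (a : Fq[X]) (x : φ.Points) :
    φ.toRing (a • x) = ∑ i ∈ Finset.range (a.natDegree + 1),
      algebraMap Fq[X] R (Polynomial.C (a.coeff i)) *
        φ.toRing ((Polynomial.X ^ i : Fq[X]) • x) := by
  conv_lhs => rw [a.as_sum_range_C_mul_X_pow]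
  rw [Finset.sum_smul, map_sum]
  refine Finset.sum_congr rfl fun i _ => ?_
  rw [mul_smul, C_smul]

/-- The valuation, as a function on the points. -/
def pointValuation (φ : TauAction Fq R) (w : Valuation R Γ) (x : φ.Points) : Γ := w (φ.toRing x)

theorem pointValuation_smul (φ : TauAction Fq R) {x : φ.Points}
    (hx : StrictMono fun k => φ.pointValuation w ((Polynomial.X ^ k : Fq[X]) • x)) {a : Fq[X]}
    (ha : a ≠ 0) : φ.pointValuation w (a • x) =
      φ.pointValuation w ((Polynomial.X ^ a.natDegree : Fq[X]) • x) := by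
  rw [pointValuation, smul_eq_sum]
  exact valuation_sum_coeff_mul w hx ha

/-- The elements of large valuation grow like `x ↦ x ^ (q ^ d)` under the action of `t`. -/
theorem exists_growth_bound {φ : TauAction Fq R} {d : ℕ} (hd : φ.HasRank d) (h0 : 0 < d)
    (hw : 1 < w (algebraMap Fq[X] R Polynomial.X))
    (hle : ∀ c : R, ∃ N : ℕ, w c ≤ w (algebraMap Fq[X] R Polynomial.X) ^ N)
    (hge : ∀ c : R, c ≠ 0 → ∃ N : ℕ, 1 ≤ w c * w (algebraMap Fq[X] R Polynomial.X) ^ N) :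
    ∃ B : ℕ, ∀ x : φ.Points,
      w (algebraMap Fq[X] R Polynomial.X) ^ (2 * B + 1) ≤ φ.pointValuation w x →
      φ.pointValuation w x < φ.pointValuation w ((Polynomial.X : Fq[X]) • x) ∧
      φ.pointValuation w ((Polynomial.X : Fq[X]) • x) ≤
        w (algebraMap Fq[X] R Polynomial.X) ^ B *
          φ.pointValuation w x ^ Fintype.card Fq ^ d ∧
      φ.pointValuation w x ^ Fintype.card Fq ^ d ≤ w (algebraMap Fq[X] R Polynomial.X) ^ B *
        φ.pointValuation w ((Polynomial.X : Fq[X]) • x) := by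
  set θ := w (algebraMap Fq[X] R Polynomial.X)
  set f := φ.toRingHom Polynomial.X
  choose N hN using hle
  obtain ⟨N', hN'⟩ := hge _ (leadingCoeff_ne_zero hd h0)
  -- `θ ^ B` bounds all coefficients of `φ_t` from above, and `θ ^ (-B)` bounds the leading one from
  -- below.
  set B := max ((Finset.range (d + 1)).sup fun i => N (f.coeff i)) N'
  have hθ : 0 < θ := zero_lt_one.trans hw
  have hc (i : ℕ) (hi : i ≤ d) : w (f.coeff i) ≤ θ ^ B :=
    (hN _).trans (pow_le_pow_right₀ hw.le ((Finset.le_sup (f := fun i => N (f.coeff i))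
      (Finset.mem_range.mpr (Nat.lt_succ_of_le hi))).trans (le_max_left _ _)))
  have hΔ : 1 ≤ w (f.coeff d) * θ ^ B :=
    hN'.trans (mul_le_mul_right (pow_le_pow_right₀ hw.le (le_max_right _ _)) _)
  refine ⟨B, fun x hx => ?_⟩
  set L := φ.pointValuation w x
  have hL1 : 1 < L := (one_lt_pow₀ hw (Nat.succ_ne_zero _)).trans_le hx
  have hL0 : 0 < L := zero_lt_one.trans hL1
  have hq : 1 < Fintype.card Fq := Fintype.one_lt_card
  have hval : φ.pointValuation w ((Polynomial.X : Fq[X]) • x) =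
      w (f.coeff d) * L ^ Fintype.card Fq ^ d := by
    have hsum : φ.toRing ((Polynomial.X : Fq[X]) • x) =
        ∑ i ∈ Finset.range (d + 1), f.coeff i * φ.toRing x ^ Fintype.card Fq ^ i :=
      evalHom_eq_sum (natDegree_X hd ▸ Nat.lt_succ_self d) (φ.toRing x)
    rw [pointValuation, hsum, valuation_sum_range_succ, map_mul, map_pow]
    · rfl
    intro i hi
    rw [map_mul, map_mul, map_pow, map_pow]
    change w (f.coeff i) * L ^ _ < w (f.coeff d) * L ^ _
    have hexp : Fintype.card Fq ^ i + 1 ≤ Fintype.card Fq ^ d := Nat.pow_lt_pow_right hq hi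
    -- One factor `θ ^ B` pays for a lower coefficient, the other for a small leading coefficient,
    -- which is why the threshold is `2 * B + 1`.
    have hθL : θ ^ B * θ ^ B < L := by
      rw [← pow_add, ← two_mul]
      exact (pow_lt_pow_right₀ hw (Nat.lt_succ_self _)).trans_le hx
    refine lt_of_mul_lt_mul_right (a := θ ^ B) ?_ zero_le
    calc w (f.coeff i) * L ^ Fintype.card Fq ^ i * θ ^ B
        ≤ θ ^ B * L ^ Fintype.card Fq ^ i * θ ^ B := by
          gcongr
          exact hc i hi.le
      _ = (θ ^ B * θ ^ B) * L ^ Fintype.card Fq ^ i := by ac_rfl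
      _ < L * L ^ Fintype.card Fq ^ i := mul_lt_mul_of_pos_right hθL (pow_pos hL0 _)
      _ = L ^ (Fintype.card Fq ^ i + 1) := (pow_succ' _ _).symm
      _ ≤ L ^ Fintype.card Fq ^ d := pow_le_pow_right₀ hL1.le hexp
      _ ≤ (w (f.coeff d) * θ ^ B) * L ^ Fintype.card Fq ^ d := le_mul_of_one_le_left' hΔ
      _ = _ := by ac_rfl
  have hlow : L ^ Fintype.card Fq ^ d ≤
      θ ^ B * φ.pointValuation w ((Polynomial.X : Fq[X]) • x) := by
    rw [hval, ← mul_assoc, mul_comm (θ ^ B)]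
    exact le_mul_of_one_le_left' hΔ
  refine ⟨?_, ?_, hlow⟩
  · refine lt_of_mul_lt_mul_left (a := θ ^ B) (lt_of_lt_of_le ?_ hlow) zero_le
    calc θ ^ B * L < L * L := mul_lt_mul_of_pos_right
          ((pow_lt_pow_right₀ hw (by omega)).trans_le hx) hL0
      _ = L ^ 2 := (sq L).symm
      _ ≤ _ := pow_le_pow_right₀ hL1.le (by
        calc 2 ≤ Fintype.card Fq := hq
          _ ≤ _ := Nat.le_self_pow h0.ne' _)
  · rw [hval]
    gcongr
    exact hc d le_rfl

/-- Starting values are spaced so that the orbits of different points under powers of `t` never meet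
in valuation. The nonzero terms of a relation then have distinct valuations and cannot cancel. -/
theorem linearIndependent_of_growth {φ : TauAction Fq R} {d : ℕ} (h0 : 0 < d)
    (hw : 1 < w (algebraMap Fq[X] R Polynomial.X)) {B : ℕ}
    (hB : ∀ x : φ.Points,
      w (algebraMap Fq[X] R Polynomial.X) ^ (2 * B + 1) ≤ φ.pointValuation w x →
      φ.pointValuation w x < φ.pointValuation w ((Polynomial.X : Fq[X]) • x) ∧
      φ.pointValuation w ((Polynomial.X : Fq[X]) • x) ≤
        w (algebraMap Fq[X] R Polynomial.X) ^ B *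
          φ.pointValuation w x ^ Fintype.card Fq ^ d ∧
      φ.pointValuation w x ^ Fintype.card Fq ^ d ≤ w (algebraMap Fq[X] R Polynomial.X) ^ B *
        φ.pointValuation w ((Polynomial.X : Fq[X]) • x))
    (e : ℕ) : ∃ P : Fin e → φ.Points, LinearIndependent Fq[X] P := by
  set θ := w (algebraMap Fq[X] R Polynomial.X)
  set Q := Fintype.card Fq ^ d
  have hθ : 0 < θ := zero_lt_one.trans hw
  have hQ : 2 ≤ Q := (Fintype.one_lt_card (α := Fq)).trans_le (Nat.le_self_pow h0.ne' _)
  -- The spacing `2 * B + 1` exceeds the error `2 * B` and separates points at equal `k`. The offset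
  -- `e + 1` keeps every `m i + 2 * B` below `2 * m j`, which separates different `k`.
  let m : Fin e → ℕ := fun i => (e + 1) * (2 * B + 1) + i * (2 * B + 1)
  -- The extra `B` in the exponent starts the lower induction at `m i + B`; the slack is reproduced
  -- at each step because `2 * B ≤ B * Q`.
  let P : Fin e → φ.Points := fun i => (algebraMap Fq[X] R Polynomial.X ^ (m i + B) : R)
  let y : Fin e → ℕ → φ.Points := fun i k => (Polynomial.X ^ k : Fq[X]) • P i
  have hy (i k) : y i (k + 1) = (Polynomial.X : Fq[X]) • y i k := by
    simp only [y, pow_succ', mul_smul]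
  have hy0 (i) : φ.pointValuation w (y i 0) = θ ^ (m i + B) := by
    have h : y i 0 = P i := by simp only [y, pow_zero, one_smul]
    rw [h]
    exact map_pow w _ _
  have hlarge (i k) : θ ^ (2 * B + 1) ≤ φ.pointValuation w (y i k) := by
    induction k with
    | zero =>
      rw [hy0]
      refine pow_le_pow_right₀ hw.le ?_
      have : 1 * (2 * B + 1) ≤ (e + 1) * (2 * B + 1) := Nat.mul_le_mul_right _ (by omega)
      simp only [m]
      omega
    | succ k ih => rw [hy]; exact ih.trans (hB _ ih).1.le
  have hmono (i) : StrictMono fun k => φ.pointValuation w (y i k) :=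
    strictMono_nat_of_lt_succ fun k => by rw [hy]; exact (hB _ (hlarge i k)).1
  have hlow (i k) : θ ^ (m i * Q ^ k + B) ≤ φ.pointValuation w (y i k) := by
    induction k with
    | zero => rw [hy0, pow_zero, mul_one]
    | succ k ih =>
      rw [hy]
      refine le_of_mul_le_mul_left (a := θ ^ B) ?_ (pow_pos hθ _)
      refine le_trans ?_ (hB _ (hlarge i k)).2.2
      calc θ ^ B * θ ^ (m i * Q ^ (k + 1) + B) = θ ^ (m i * Q ^ (k + 1) + 2 * B) := by
            rw [← pow_add]; congr 1; ring
        _ ≤ θ ^ ((m i * Q ^ k + B) * Q) := pow_le_pow_right₀ hw.le (by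
            have h1 := Nat.mul_le_mul_left B hQ
            have h2 : (m i * Q ^ k + B) * Q = m i * Q ^ (k + 1) + B * Q := by ring
            rw [h2]
            linarith)
        _ = (θ ^ (m i * Q ^ k + B)) ^ Q := pow_mul _ _ _
        _ ≤ _ := pow_le_pow_left₀ zero_le ih _
  have hupp (i k) : θ ^ B * φ.pointValuation w (y i k) ≤ θ ^ ((m i + 2 * B) * Q ^ k) := by
    induction k with
    | zero => rw [hy0, ← pow_add, pow_zero, mul_one]; exact pow_le_pow_right₀ hw.le (by omega)
    | succ k ih =>
      rw [hy]
      calc _ ≤ θ ^ B * (θ ^ B * φ.pointValuation w (y i k) ^ Q) :=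
            mul_le_mul_right (hB _ (hlarge i k)).2.1 _
        _ = θ ^ (B * 2) * φ.pointValuation w (y i k) ^ Q := by
            rw [← mul_assoc, ← pow_add, mul_two]
        _ ≤ θ ^ (B * Q) * φ.pointValuation w (y i k) ^ Q := mul_le_mul_left
            (pow_le_pow_right₀ hw.le (Nat.mul_le_mul_left B hQ)) _
        _ = (θ ^ B * φ.pointValuation w (y i k)) ^ Q := by rw [mul_pow, pow_mul]
        _ ≤ (θ ^ ((m i + 2 * B) * Q ^ k)) ^ Q := pow_le_pow_left₀ zero_le ih _
        _ = _ := by rw [← pow_mul, pow_succ, mul_assoc]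
  have hsep (i j k l) (h : (m i + 2 * B) * Q ^ k < m j * Q ^ l) :
      φ.pointValuation w (y i k) < φ.pointValuation w (y j l) := by
    refine lt_of_mul_lt_mul_left (a := θ ^ B) ((hupp i k).trans_lt ?_) zero_le
    refine (pow_lt_pow_right₀ hw h).trans_le (le_trans (pow_le_pow_right₀ hw.le ?_)
      ((hlow j l).trans (le_mul_of_one_le_left' (one_le_pow₀ hw.le))))
    omega
  have hlt (i j k l) (h : k < l) :
      φ.pointValuation w (y i k) < φ.pointValuation w (y j l) := by
    apply hsep
    have h1 : m i + 2 * B < m j * Q := by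
      have hi : (i : ℕ) * (2 * B + 1) + 1 * (2 * B + 1) ≤ e * (2 * B + 1) := by
        rw [← add_mul]; exact Nat.mul_le_mul_right _ i.2
      have h2 : m j * 2 ≤ m j * Q := Nat.mul_le_mul_left _ hQ
      have hmi : m i = e * (2 * B + 1) + (2 * B + 1) + i * (2 * B + 1) := by
        simp only [m]; ring
      have hmj : e * (2 * B + 1) + (2 * B + 1) ≤ m j := by
        simp only [m]; rw [add_one_mul]; exact Nat.le_add_right _ _
      rw [hmi]
      linarith
    calc (m i + 2 * B) * Q ^ k < m j * Q * Q ^ k :=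
          Nat.mul_lt_mul_of_pos_right h1 (by positivity)
      _ = m j * Q ^ (k + 1) := by rw [pow_succ']; ring
      _ ≤ _ := Nat.mul_le_mul_left _ (Nat.pow_le_pow_right (by omega) h)
  have hlt' (i j k) (h : i < j) : φ.pointValuation w (y i k) < φ.pointValuation w (y j k) := by
    apply hsep
    refine Nat.mul_lt_mul_of_pos_right ?_ (by positivity)
    have : (i + 1 : ℕ) * (2 * B + 1) ≤ j * (2 * B + 1) := Nat.mul_le_mul_right _ h
    rw [add_mul] at this
    simp only [m]
    omega
  have hne (i j k l) (h : i ≠ j) : φ.pointValuation w (y i k) ≠ φ.pointValuation w (y j l) := by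
    rcases lt_trichotomy k l with hkl | rfl | hkl
    · exact (hlt i j k l hkl).ne
    · rcases lt_or_gt_of_ne h with hij | hij
      · exact (hlt' i j k hij).ne
      · exact (hlt' j i k hij).ne'
    · exact (hlt j i l k hkl).ne'
  refine ⟨P, Fintype.linearIndependent_iff.mpr fun a hsum => ?_⟩
  have hempty := eq_zero_of_sum_eq_zero (w := w) (f := fun i => φ.toRing (a i • P i))
    {i | a i ≠ 0} ?_ ?_ ?_ hsum
  · intro i
    by_contra hi
    exact (hempty ▸ (show i ∈ {i | a i ≠ 0} from hi) : i ∈ (∅ : Set (Fin e)))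
  · intro i hi
    rw [show a i = 0 from not_not.mp hi]
    exact zero_smul Fq[X] (P i)
  · intro i hi
    have h1 := pointValuation_smul φ (hmono i) hi
    refine ne_of_eq_of_ne h1 (ne_zero_of_lt (lt_of_lt_of_le (pow_pos hθ _) (hlarge i _)))
  · intro i hi j hj hij
    have h1 := pointValuation_smul φ (hmono i) hi
    have h2 := pointValuation_smul φ (hmono j) hj
    exact fun h => hne i j _ _ hij (h1.symm.trans (h.trans h2))

end Growth

variable {Fq : Type*} [Field Fq] [Fintype Fq]
  {K : Type*} [Field K] [Algebra Fq[X] K] [Algebra Fq⟮X⟯ K] [IsScalarTower Fq[X] Fq⟮X⟯ K]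
  [FunctionField Fq K]

theorem exists_linearIndependent {φ : TauAction Fq (FunctionField.ringOfIntegers Fq K)} {d : ℕ}
    (hd : φ.HasRank d) (h0 : 0 < d) (e : ℕ) :
    ∃ P : Fin e → φ.Points, LinearIndependent Fq[X] P := by
  obtain ⟨V, hV⟩ := exists_valuationSubring_X_notMem (FunctionField.algebraMap_injective Fq K)
  let w : Valuation (FunctionField.ringOfIntegers Fq K) _ :=
    V.valuation.comap (algebraMap (FunctionField.ringOfIntegers Fq K) K)
  have hw : 1 < w (algebraMap Fq[X] (FunctionField.ringOfIntegers Fq K) Polynomial.X) :=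
    not_le.mp fun h => hV (V.mem_of_valuation_le_one _ h)
  have hle (c : FunctionField.ringOfIntegers Fq K) := exists_valuation_le_pow hw
    (IsIntegralClosure.isIntegral Fq[X] K c)
  -- The lower bound for `c` comes from a multiple `c * b = a` in `A`, nonzero and hence of
  -- valuation at least `1`, together with the upper bound for `b`.
  obtain ⟨B, hB⟩ := exists_growth_bound hd h0 hw hle fun c hc => by
    obtain ⟨a, ha, b, hb⟩ := exists_dvd_algebraMap hc
    obtain ⟨N, hN⟩ := hle b
    refine ⟨N, le_trans ?_ (mul_le_mul_right hN (w c))⟩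
    rw [← map_mul, ← hb, valuation_algebraMap hw ha]
    exact one_le_pow₀ hw.le
  exact linearIndependent_of_growth h0 hw hB e

end TauAction

end Drinfeld

namespace Drinfeld

open TwistedPolynomial

namespace TauAction

/-! ### The modules `{M P : tr (C M) = 0}` -/

section TraceZero

variable {Fq : Type*} [Field Fq] [Fintype Fq] {R S : Type*} [CommRing R] [Algebra Fq[X] R]
  [CommRing S] [Algebra Fq[X] S] {φ : TauAction Fq R} {ψ : TauAction Fq S} {e : ℕ}

theorem map_matMul (θ : φ.Points →ₗ[Fq[X]] ψ.Points) (M : Matrix (Fin e) (Fin e) Fq[X])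
    (P : Fin e → φ.Points) (i : Fin e) :
    θ (matMul M P i) = matMul M (fun j => θ (P j)) i := by
  simp only [matMul, map_sum, map_smul]

/-- The `A`-submodule `{M P : tr (C M) = 0}` of `φ(R)^e`. -/
def twistedTraceZeroSubmodule (C : Matrix (Fin e) (Fin e) Fq[X]) (P : Fin e → φ.Points) :
    Submodule Fq[X] (Fin e → φ.Points) where
  carrier := {Q | ∃ M : Matrix (Fin e) (Fin e) Fq[X], (C * M).trace = 0 ∧ Q = matMul M P}
  zero_mem' := ⟨0, by simp, by ext i; simp [matMul]⟩
  add_mem' := by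
    rintro _ _ ⟨M, hM, rfl⟩ ⟨N, hN, rfl⟩
    refine ⟨M + N, by simp [Matrix.mul_add, hM, hN], ?_⟩
    ext i
    simp [matMul, add_smul, Finset.sum_add_distrib]
  smul_mem' := by
    rintro a _ ⟨M, hM, rfl⟩
    refine ⟨a • M, by simp [hM], ?_⟩
    ext i
    simp [matMul, mul_smul, Finset.smul_sum]

theorem twistedTraceZeroSubmodule_one (P : Fin e → φ.Points) :
    twistedTraceZeroSubmodule 1 P = traceZeroSubmodule P := by
  ext Q
  change (∃ M : Matrix (Fin e) (Fin e) Fq[X], (1 * M).trace = 0 ∧ Q = matMul M P) ↔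
    ∃ M : Matrix (Fin e) (Fin e) Fq[X], M.trace = 0 ∧ Q = matMul M P
  simp only [Matrix.one_mul]

theorem twistedTraceZeroSubmodule_le (C : Matrix (Fin e) (Fin e) Fq[X]) (P : Fin e → φ.Points) :
    twistedTraceZeroSubmodule C P ≤
      powSubmodule (Submodule.span Fq[X] (Set.range P)) e := by
  rintro _ ⟨M, -, rfl⟩ i -
  exact Submodule.sum_mem _ fun j _ => Submodule.smul_mem _ _ (Submodule.subset_span ⟨j, rfl⟩)

theorem mem_powSubmodule_span (P : Fin e → φ.Points) :
    P ∈ powSubmodule (Submodule.span Fq[X] (Set.range P)) e :=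
  fun i _ => Submodule.subset_span ⟨i, rfl⟩

theorem matMul_eq_zero_iff {P : Fin e → φ.Points} (hP : LinearIndependent Fq[X] P)
    {M : Matrix (Fin e) (Fin e) Fq[X]} : matMul M P = 0 ↔ M = 0 := by
  refine ⟨fun h => ?_, fun h => ?_⟩
  · exact Matrix.ext fun i j => Fintype.linearIndependent_iff.mp hP (M i) (congrFun h i) j
  · rw [h]; ext i; simp [matMul]

theorem smul_matMul (a : Fq[X]) (M : Matrix (Fin e) (Fin e) Fq[X]) (P : Fin e → φ.Points) :
    matMul (a • M) P = a • matMul M P := by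
  ext i
  simp [matMul, mul_smul, Finset.smul_sum]

/-- If `P - M P` is killed by `a ≠ 0`, independence gives `a • (1 - M) = 0`, so `M = 1` and the
trace condition becomes one on `C`. -/
theorem mem_twistedTraceZeroSubmodule_sup_torsion_iff {P : Fin e → φ.Points}
    (hP : LinearIndependent Fq[X] P) (C : Matrix (Fin e) (Fin e) Fq[X]) :
    P ∈ twistedTraceZeroSubmodule C P ⊔ Submodule.torsion Fq[X] (Fin e → φ.Points) ↔
      C.trace = 0 := by
  constructor
  · intro h
    obtain ⟨_, ⟨M, hM, rfl⟩, T, hT, hsum⟩ := Submodule.mem_sup.mp h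
    obtain ⟨a, ha⟩ := (Submodule.mem_torsion_iff T).mp hT
    have hT' : T = matMul (1 - M) P := by
      rw [sub_matMul, one_matMul]
      exact eq_sub_of_add_eq' hsum
    have h0 : matMul ((a : Fq[X]) • (1 - M)) P = 0 := by
      rw [smul_matMul, ← hT']
      exact ha
    rw [matMul_eq_zero_iff hP, smul_eq_zero_iff_right (nonZeroDivisors.coe_ne_zero a),
      sub_eq_zero] at h0
    rwa [← h0, Matrix.mul_one] at hM
  · intro h
    exact Submodule.mem_sup_left ⟨1, by rwa [Matrix.mul_one], (one_matMul P).symm⟩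

theorem exists_mem_twistedTraceZeroSubmodule [IsDomain S] [Finite S] {d : ℕ} (h0 : 0 < d)
    (hd : ψ.HasRank d) (θ : φ.Points →ₗ[Fq[X]] ψ.Points) (P : Fin (d + 1) → φ.Points)
    {C : Matrix (Fin (d + 1)) (Fin (d + 1)) Fq[X]} (hC : IsUnit C) :
    ∃ Q ∈ twistedTraceZeroSubmodule C P, ∀ i, θ (Q i) = θ (P i) := by
  obtain ⟨M, hM, hfix⟩ := exists_matMul_eq_self h0 hd (fun i => θ (P i)) hC
  refine ⟨matMul M P, ⟨M, hM, rfl⟩, fun i => ?_⟩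
  rw [map_matMul, hfix]

/-- The identity works unless `d + 1` vanishes in `k`. In that case `(1 + E_{0d})(1 + E_{d0})` has
determinant `1` and trace `d + 2 = 1`; the two indices differ because `d > 0`. -/
theorem exists_isUnit_trace_ne_zero {k : Type*} [Field k] {d : ℕ} (h0 : 0 < d) :
    ∃ C : Matrix (Fin (d + 1)) (Fin (d + 1)) k[X], IsUnit C ∧ C.trace ≠ 0 := by
  by_cases h : ((d + 1 : ℕ) : k[X]) = 0
  · have hne : (0 : Fin (d + 1)) ≠ Fin.last d := by
      intro h; have := congrArg Fin.val h; simp at this; omega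
    refine ⟨Matrix.transvection 0 (Fin.last d) 1 * Matrix.transvection (Fin.last d) 0 1, ?_, ?_⟩
    · rw [Matrix.isUnit_iff_isUnit_det, Matrix.det_mul, Matrix.det_transvection_of_ne _ _ hne,
        Matrix.det_transvection_of_ne _ _ hne.symm, one_mul]
      exact isUnit_one
    · have : (Matrix.transvection 0 (Fin.last d) 1 *
          Matrix.transvection (Fin.last d) 0 1 : Matrix (Fin (d + 1)) (Fin (d + 1)) k[X]).trace =
          ((d + 1 : ℕ) : k[X]) + 1 := by
        simp [Matrix.transvection, Matrix.add_mul, Matrix.mul_add, Matrix.trace_single_eq_of_ne,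
          hne, hne.symm]
      rw [this, h, zero_add]
      exact one_ne_zero
  · exact ⟨1, isUnit_one, by rwa [Matrix.trace_one, Fintype.card_fin]⟩

end TraceZero

end TauAction

namespace TwistedPolynomial

variable {Fq : Type*} [Field Fq] [Fintype Fq] {R : Type*} [CommRing R] [Algebra Fq[X] R]

theorem coeff_mul_monomial_zero (f : TwistedPolynomial Fq R) (r : R) (n : ℕ) :
    (f * monomial Fq 0 r).coeff n = f.coeff n * r ^ Fintype.card Fq ^ n := by
  induction f using induction with
  | h0 => rw [zero_mul, coeff_zero_apply, zero_mul]
  | h m s g ih =>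
    rw [add_mul, coeff_add, coeff_add, ih, monomial_mul_monomial, coeff_monomial, coeff_monomial,
      add_zero, add_mul]
    split_ifs with h
    · rw [h]
    · rw [zero_mul]

end TwistedPolynomial

open TauAction

/-! ### Reduction at good models -/

section GoodModels

variable {Fq : Type*} [Field Fq] [Fintype Fq] {O : Type*} [CommRing O] [Algebra Fq[X] O]
  {K : Type*} [Field K] [Algebra Fq[X] K] [Algebra O K] [IsScalarTower Fq[X] O K]
  [FaithfulSMul O K]

theorem locToField_algebraMap (W : Ideal O) [W.IsPrime] (x : O) :
    locToField (Fq := Fq) K W (algebraMap O _ x) = algebraMap O K x :=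
  IsLocalization.lift_eq _ x

theorem locToField_injective (W : Ideal O) [W.IsPrime] :
    Function.Injective (locToField (Fq := Fq) K W) := by
  rw [injective_iff_map_eq_zero]
  intro y hy
  obtain ⟨x, s, rfl⟩ := IsLocalization.exists_mk'_eq W.primeCompl y
  have h := congrArg (locToField (Fq := Fq) K W) (IsLocalization.mk'_spec (Localization.AtPrime W) x s)
  rw [map_mul, hy, zero_mul, locToField_algebraMap] at h
  have hx : x = 0 := FaithfulSMul.algebraMap_injective O K (by rw [← h, map_zero])
  rw [hx, IsLocalization.mk'_zero]

/-- With `α ^ n = x / s`, the power `(α s) ^ n = x s ^ (n - 1)` lies in `O`, so normality puts `α s`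
in `O`. -/
theorem mem_range_locToField_of_pow [IsIntegrallyClosed O] [IsFractionRing O K] (W : Ideal O)
    [W.IsPrime] {α : K} {n : ℕ} (hn : 0 < n)
    (h : α ^ n ∈ Set.range (locToField (Fq := Fq) K W)) :
    α ∈ Set.range (locToField (Fq := Fq) K W) := by
  obtain ⟨β, hβ⟩ := h
  obtain ⟨x, s, rfl⟩ := IsLocalization.exists_mk'_eq W.primeCompl β
  have hs : algebraMap O K s ≠ 0 := fun h0 => s.2 <| by
    rw [FaithfulSMul.algebraMap_injective O K (h0.trans (map_zero _).symm)]
    exact W.zero_mem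
  have h1 := congrArg (locToField (Fq := Fq) K W)
    (IsLocalization.mk'_spec (Localization.AtPrime W) x s)
  rw [map_mul, hβ, locToField_algebraMap, locToField_algebraMap] at h1
  have hint : IsIntegral O ((α * algebraMap O K s) ^ n) := by
    obtain ⟨k, rfl⟩ := Nat.exists_eq_succ_of_ne_zero hn.ne'
    rw [mul_pow, pow_succ (algebraMap O K s), mul_comm (algebraMap O K s ^ k), ← mul_assoc, h1,
      ← map_pow, ← map_mul]
    exact isIntegral_algebraMap
  obtain ⟨y, hy⟩ := IsIntegrallyClosed.exists_algebraMap_eq_of_isIntegral_pow hn hint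
  refine ⟨IsLocalization.mk' _ y s, mul_right_cancel₀ hs ?_⟩
  rw [← hy, ← locToField_algebraMap (Fq := Fq) W s, ← map_mul, IsLocalization.mk'_spec,
    locToField_algebraMap]

variable {φ : TauAction Fq O} {d : ℕ} {W : Ideal O} [W.IsPrime] {α : K}
  {φ₁ : TauAction Fq (Localization.AtPrime W)}

/-- Comparing leading coefficients of `φ_t` and of the model gives `Δ₁ α ^ (q ^ d) = α Δ`. Good
reduction makes `Δ₁` a unit at `W`, so `α ^ (q ^ d - 1)` is `W`-integral, and hence so is `α`. -/
theorem IsGoodModel.exists_locToField_eq [IsIntegrallyClosed O] [IsFractionRing O K]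
    (h : IsGoodModel φ d W α φ₁) : ∃ β, locToField (Fq := Fq) K W β = α := by
  have h0 : 0 < d := h.hasRank.pos h.isDrinfeldModule
  have hcoeff := congrArg (fun f => f.coeff d) (h.conj Polynomial.X)
  simp only [coeff_mul_monomial_zero, coeff_monomial_mul, Nat.zero_le, if_true, pow_zero, pow_one,
    Nat.sub_zero] at hcoeff
  change (TwistedPolynomial.map _ (φ₁.toRingHom Polynomial.X)).coeff d * _ =
    α * (TwistedPolynomial.map _ (φ.toRingHom Polynomial.X)).coeff d at hcoeff
  rw [coeff_map, coeff_map] at hcoeff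
  have hunit : IsUnit ((φ₁.toRingHom Polynomial.X).coeff d) := by
    have h1 := leadingCoeff_ne_zero h.hasRank h0
    change (TwistedPolynomial.map _ (φ₁.toRingHom Polynomial.X)).coeff d ≠ 0 at h1
    rw [coeff_map] at h1
    exact (IsLocalRing.residue_ne_zero_iff_isUnit _).mp h1
  obtain ⟨u, hu⟩ := hunit.exists_left_inv
  have hq : 1 < Fintype.card Fq ^ d := Nat.one_lt_pow h0.ne' Fintype.one_lt_card
  obtain ⟨k, hk⟩ := Nat.exists_eq_add_of_lt hq
  rw [hk] at hcoeff
  -- Here `k + 1 = q ^ d - 1`, which is positive.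
  refine mem_range_locToField_of_pow (Fq := Fq) W (n := k + 1) (Nat.succ_pos _)
    ⟨u * algebraMap O _ ((φ.toRingHom Polynomial.X).coeff d), ?_⟩
  rw [map_mul, locToField_algebraMap]
  apply mul_left_cancel₀ h.ne_zero
  rw [mul_left_comm]
  refine (congrArg _ hcoeff.symm).trans ?_
  rw [← mul_assoc, ← map_mul, hu, map_one, one_mul]
  ring

theorem IsGoodModel.evalHom_mul (h : IsGoodModel φ d W α φ₁) {β : Localization.AtPrime W}
    (hβ : locToField (Fq := Fq) K W β = α) (a : Fq[X]) (x : O) :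
    evalHom Fq _ (φ₁.toRingHom a) (β * algebraMap O _ x) =
      β * algebraMap O _ (evalHom Fq O (φ.toRingHom a) x) := by
  apply locToField_injective (Fq := Fq) (K := K) W
  have hconj := DFunLike.congr_fun (congrArg (evalHom Fq K) (h.conj a)) (algebraMap O K x)
  rw [map_mul, map_mul] at hconj
  change evalHom Fq K (TwistedPolynomial.map _ (φ₁.toRingHom a))
      (evalHom Fq K (monomial Fq 0 α) _) =
    evalHom Fq K (monomial Fq 0 α) (evalHom Fq K (TwistedPolynomial.map _ (φ.toRingHom a)) _)
    at hconj
  rw [evalHom_monomial, evalHom_monomial, pow_zero, pow_one, pow_one] at hconj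
  rw [evalHom_map, map_mul (locToField K W), map_mul (locToField K W), locToField_algebraMap, locToField_algebraMap, hβ, hconj]
  exact congrArg (α * ·) (evalHom_map (IsScalarTower.toAlgHom Fq[X] O K) _ x).symm

/-- Multiplication by `α`, as a homomorphism of `A`-modules from `φ` to a good model. -/
def IsGoodModel.toModel (h : IsGoodModel φ d W α φ₁) (β : Localization.AtPrime W)
    (hβ : locToField (Fq := Fq) K W β = α) : φ.Points →ₗ[Fq[X]] φ₁.Points :=
  let g : O →+ Localization.AtPrime W :=
    (AddMonoidHom.mulLeft β).comp (algebraMap O (Localization.AtPrime W)).toAddMonoidHom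
  { toFun := g
    map_add' := g.map_add
    map_smul' := fun a x => (h.evalHom_mul hβ a x).symm }

/-- The reduction `x ↦ α x mod W` at a good model, as a homomorphism of `A`-modules. -/
def IsGoodModel.reduction (h : IsGoodModel φ d W α φ₁) (β : Localization.AtPrime W)
    (hβ : locToField (Fq := Fq) K W β = α) :
    φ.Points →ₗ[Fq[X]] (φ₁.map (locToResidue W)).Points :=
  (φ₁.pointsMap (locToResidue W)).comp (h.toModel β hβ)

theorem IsGoodModel.reducesTo (h : IsGoodModel φ d W α φ₁) (β : Localization.AtPrime W)
    (hβ : locToField (Fq := Fq) K W β = α) (x : φ.Points) :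
    ReducesTo φ W α φ₁ x (h.reduction β hβ x) :=
  ⟨h.toModel β hβ x,
    (map_mul (locToField K W) β (algebraMap O _ x)).trans (congrArg₂ _ hβ (locToField_algebraMap W _)), rfl⟩

theorem locallyInAtGoodPrimes_twistedTraceZeroSubmodule [IsIntegrallyClosed O]
    [IsFractionRing O K] (hfin : ∀ (W : Ideal O) [W.IsMaximal], Finite (O ⧸ W))
    (P : Fin (d + 1) → φ.Points) {C : Matrix (Fin (d + 1)) (Fin (d + 1)) Fq[X]} (hC : IsUnit C) :
    LocallyInAtGoodPrimes K φ d P (twistedTraceZeroSubmodule C P) := by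
  intro W _ α φ₁ h
  obtain ⟨β, hβ⟩ := h.exists_locToField_eq
  have := hfin W
  have : Finite W.ResidueField :=
    Finite.of_surjective _ W.bijective_algebraMap_quotient_residueField.surjective
  obtain ⟨Q, hQ, hQP⟩ := exists_mem_twistedTraceZeroSubmodule
    (h.hasRank.pos h.isDrinfeldModule) h.hasRank (h.reduction β hβ) P hC
  refine ⟨fun i => h.reduction β hβ (P i), fun i => h.reducesTo β hβ (P i), Q, hQ, fun i => ?_⟩
  have hred := h.reducesTo β hβ (Q i)
  rwa [hQP i] at hred

/-- Outside the primes containing the leading coefficient of `φ_t`, plain reduction keeps the rank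
`d`, so no change of model is needed. -/
theorem red_mem_map_twistedTraceZeroSubmodule (hd : φ.HasRank d) (h0 : 0 < d) (W : Ideal O)
    [W.IsMaximal] [Finite (O ⧸ W)] (hW : (φ.toRingHom Polynomial.X).coeff d ∉ W)
    (P : Fin (d + 1) → φ.Points) {C : Matrix (Fin (d + 1)) (Fin (d + 1)) Fq[X]} (hC : IsUnit C) :
    red φ (d + 1) W P ∈ (twistedTraceZeroSubmodule C P).map (red φ (d + 1) W) := by
  have hrank : (φ.map (reduceMod W)).HasRank d :=
    hd.map h0 _ fun h => hW (Ideal.Quotient.eq_zero_iff_mem.mp h)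
  obtain ⟨Q, hQ, hQP⟩ := exists_mem_twistedTraceZeroSubmodule h0 hrank
    (φ.pointsMap (reduceMod W)) P hC
  exact ⟨Q, hQ, funext hQP⟩

end GoodModels

end Drinfeld

end

/-! ### The main theorem -/

theorem mainTheorem4
    {Fq : Type*} [Field Fq] [Fintype Fq]
    {K : Type*} [Field K] [Algebra Fq[X] K] [Algebra Fq⟮X⟯ K] [IsScalarTower Fq[X] Fq⟮X⟯ K]
    [FunctionField Fq K]
    (φ : Drinfeld.TauAction Fq (FunctionField.ringOfIntegers Fq K)) (d : ℕ)
    (hφ : φ.IsDrinfeldModule) (hd : φ.HasRank d)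
    (hEnd : (φ.map (IsScalarTower.toAlgHom Fq[X] (FunctionField.ringOfIntegers Fq K) K)).EndEqA) :
    (∃ P : Fin (d + 1) → φ.Points, LinearIndependent Fq[X] P) ∧
    (∀ P : Fin (d + 1) → φ.Points, LinearIndependent Fq[X] P →
      Drinfeld.LocallyInAtGoodPrimes K φ d P (Drinfeld.TauAction.traceZeroSubmodule P) ∧
      (P ∉ Drinfeld.TauAction.traceZeroSubmodule P ⊔
          Submodule.torsion Fq[X] (Fin (d + 1) → φ.Points) ↔ ((d + 1 : ℕ) : Fq) ≠ 0) ∧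
      ∃ Λ : Submodule Fq[X] (Fin (d + 1) → φ.Points),
        Λ ≤ Drinfeld.TauAction.powSubmodule (Submodule.span Fq[X] (Set.range P)) (d + 1) ∧
        Drinfeld.LocallyInAtGoodPrimes K φ d P Λ ∧
        P ∉ Λ ⊔ Submodule.torsion Fq[X] (Fin (d + 1) → φ.Points)) ∧
    ¬ Drinfeld.LocalGlobalPrinciple φ (d + 1) := by

  have h0 : 0 < d := hd.pos hφ
  have hfin : ∀ (W : Ideal (FunctionField.ringOfIntegers Fq K)) [W.IsMaximal],
      Finite (FunctionField.ringOfIntegers Fq K ⧸ W) :=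
    fun W _ => Drinfeld.finite_quotient_of_isMaximal W
  -- One matrix, chosen independently of `P`, serves both for the submodule valid in every
  -- characteristic and for refuting the principle.
  obtain ⟨C, hC, hC0⟩ := Drinfeld.TauAction.exists_isUnit_trace_ne_zero (k := Fq) h0
  refine ⟨Drinfeld.TauAction.exists_linearIndependent hd h0 (d + 1),
    fun P hP => ⟨?_, ?_, Drinfeld.TauAction.twistedTraceZeroSubmodule C P, ?_, ?_, ?_⟩, ?_⟩
  · rw [← Drinfeld.TauAction.twistedTraceZeroSubmodule_one]
    exact Drinfeld.locallyInAtGoodPrimes_twistedTraceZeroSubmodule hfin P isUnit_one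
  · rw [← Drinfeld.TauAction.twistedTraceZeroSubmodule_one, not_iff_not,
      Drinfeld.TauAction.mem_twistedTraceZeroSubmodule_sup_torsion_iff hP, Matrix.trace_one,
      Fintype.card_fin, ← map_natCast (Polynomial.C : Fq →+* Fq[X]), Polynomial.C_eq_zero]
  · exact Drinfeld.TauAction.twistedTraceZeroSubmodule_le C P
  · exact Drinfeld.locallyInAtGoodPrimes_twistedTraceZeroSubmodule hfin P hC
  · rwa [Drinfeld.TauAction.mem_twistedTraceZeroSubmodule_sup_torsion_iff hP]
  · intro hlg
    obtain ⟨P, hP⟩ := Drinfeld.TauAction.exists_linearIndependent hd h0 (d + 1)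
    refine hC0 ((Drinfeld.TauAction.mem_twistedTraceZeroSubmodule_sup_torsion_iff hP C).mp ?_)
    refine SetLike.le_def.mp (sup_le_sup_left inf_le_right _)
      (hlg _ (Submodule.fg_span (Set.finite_range P)) _
        (Drinfeld.TauAction.twistedTraceZeroSubmodule_le C P) P
        (Drinfeld.TauAction.mem_powSubmodule_span P) ?_)
    -- The exceptional primes all contain the leading coefficient of `φ_t`, so they are finite in
    -- number.
    refine (Drinfeld.finite_maximalSpectrum_mem
      (Drinfeld.TauAction.leadingCoeff_ne_zero hd h0)).subset fun W hW => ?_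
    by_contra hmem
    have := hfin W.asIdeal
    exact hW (Drinfeld.red_mem_map_twistedTraceZeroSubmodule hd h0 W.asIdeal hmem P hC)
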